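/- Let $n,p\ge 1$ be integers, let $B$ be the open unit ball of $\mathbb{R}^n$, let $\widehat{B}_p=\bigcup_{k=0}^{p-1}e^{k\pi i/p}B\subset\mathbb{C}^n$, and let $\alpha,\beta\in\mathbb{R}$ with $n+\alpha>0$ and $\beta>-1$. Let $\mathcal{A}_{\Delta^p}(B)$ be the space of complex-valued real-analytic functions $u$ on $B$ with $\Delta^p u=0$. Every $u\in\mathcal{A}_{\Delta^p}(B)$ is the restriction to $B$ of a function holomorphic in a neighbourhood in $\mathbb{C}^n$ of $\{e^{i\psi}x:\psi\in\mathbb{R},\,x\in B\}$, and the values of such a function on $\widehat{B}_p$ are uniquely determined by $u$; the function so obtained on $\widehat{B}_p$ is again denoted by $u$. Let $L^2(\widehat{B}_p,|y|^\alpha(1-|y|^2)^\beta dy)$ be the Hilbert space of (classes of) measurable functions $u:\widehat{B}_p\to\mathbb{C}$ with $\langle u,u\rangle<\infty$, where $$\langle u,v\rangle=\frac1p\sum_{k=0}^{p-1}\int_B u(e^{k\pi i/p}y)\,\overline{v(e^{k\pi i/p}y)}\,|y|^\alpha(1-|y|^2)^\beta\,dy ,$$ and let $b^2_{p,\alpha,\beta}(\widehat{B}_p)$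 be the set of those $u\in\mathcal{A}_{\Delta^p}(B)$, extended to $\widehat{B}_p$ as above, that belong to it. Then $b^2_{p,\alpha,\beta}(\widehat{B}_p)$ is a closed subspace of the Hilbert space $L^2(\widehat{B}_p,|y|^\alpha(1-|y|^2)^\beta dy)$ with the inner product $\langle\cdot,\cdot\rangle$ (two elements of $b^2_{p,\alpha,\beta}(\widehat{B}_p)$ that agree almost everywhere are equal). Hence it is a Hilbert space, and it has a unique reproducing kernel: there is exactly one function $R:\widehat{B}_p\times\widehat{B}_p\to\mathbb{C}$ such that for every $x\in\widehat{B}_p$ one has $R(x,\cdot)\in b^2_{p,\alpha,\beta}(\widehat{B}_p)$ and $u(x)=\langle u,R(x,\cdot)\rangle$ for all $u\in b^2_{p,\alpha,\beta}(\widehat{B}_p)$. -/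

import Mathlib

open MeasureTheory

noncomputable section

/-- The open unit ball `B` of `ℝⁿ`. -/
abbrev unitBall (n : ℕ) : Set (EuclideanSpace ℝ (Fin n)) := Metric.ball 0 1

/-- The vector `e^{iφ} x` of `ℂⁿ`, for a real vector `x` and an angle `φ`. -/
def rotVec {n : ℕ} (φ : ℝ) (x : EuclideanSpace ℝ (Fin n)) : EuclideanSpace ℂ (Fin n) :=
  Complex.exp (φ * Complex.I) • WithLp.toLp 2 (fun i => (x i : ℂ))

/-- The set `{e^{iψ} x : ψ ∈ ℝ, x ∈ B}` in `ℂⁿ`. -/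
def allRotations (n : ℕ) : Set (EuclideanSpace ℂ (Fin n)) :=
  {z | ∃ ψ : ℝ, ∃ x ∈ unitBall n, z = rotVec ψ x}

/-- The union of rotated balls `⋃_{k=0}^{p-1} e^{kπi/p} B` in `ℂⁿ`. -/
def hatB (n p : ℕ) : Set (EuclideanSpace ℂ (Fin n)) :=
  ⋃ k : Fin p, rotVec (((k : ℕ) : ℝ) * Real.pi / p) '' unitBall n

/-- The `k`-th rotation `y ↦ e^{kπi/p} y`, as a map from `B` to the union of rotated balls. -/
def rot {n p : ℕ} (k : Fin p) (y : unitBall n) : hatB n p :=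
  ⟨rotVec (((k : ℕ) : ℝ) * Real.pi / p) y, Set.mem_iUnion.2 ⟨k, y, y.2, rfl⟩⟩

/-- `u` is polyharmonic of order `p` on `s`: it is real analytic there and `Δᵖ u = 0` on `s`.
(For open `s` this depends on the values of `u` on `s` only.) -/
def IsPolyharmonicOn {n : ℕ} (p : ℕ) (u : EuclideanSpace ℝ (Fin n) → ℂ)
    (s : Set (EuclideanSpace ℝ (Fin n))) : Prop :=
  AnalyticOnNhd ℝ u s ∧
    ∀ x ∈ s, (fun v : EuclideanSpace ℝ (Fin n) → ℂ => Laplacian.laplacian v)^[p] u x = 0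

/-- `w` is the function on the union of the rotated balls that is obtained from the function `u`
on `B` by holomorphic extension: some function that is holomorphic in a neighbourhood (in `ℂⁿ`) of
`{e^{iψ} x : ψ ∈ ℝ, x ∈ B}` coincides with `u` on `B` and with `w` on the rotated balls. -/
def IsRotExtension {n p : ℕ} (u : EuclideanSpace ℝ (Fin n) → ℂ) (w : hatB n p → ℂ) : Prop :=
  ∃ F : EuclideanSpace ℂ (Fin n) → ℂ, AnalyticOnNhd ℂ F (allRotations n) ∧
    (∀ x ∈ unitBall n, F (rotVec 0 x) = u x) ∧ ∀ z : hatB n p, F z = w z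

/-- The weight `|y|^α (1 - |y|²)^β`. -/
def weight {n : ℕ} (α β : ℝ) (y : EuclideanSpace ℝ (Fin n)) : ℝ :=
  ‖y‖ ^ α * (1 - ‖y‖ ^ 2) ^ β

/-- Lebesgue measure on `B`. -/
def ballVolume (n : ℕ) : Measure (unitBall n) :=
  Measure.comap (fun y : unitBall n => (y : EuclideanSpace ℝ (Fin n))) volume

/-- The measure on the union of rotated balls for which
`∫ f dμ = (1/p) ∑_{k<p} ∫_B f(e^{kπi/p} y) |y|^α (1 - |y|²)^β dy`. -/
def hatMeasure (n p : ℕ) (α β : ℝ) : Measure (hatB n p) :=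
  (p : ENNReal)⁻¹ • ∑ k : Fin p,
    ((ballVolume n).withDensity
      (fun y => ENNReal.ofReal (weight α β (y : EuclideanSpace ℝ (Fin n))))).map (rot k)

/-- The Hilbert space `L²` of the union of rotated balls, with weight `|y|^α (1 - |y|²)^β`. -/
abbrev HatL2 (n p : ℕ) (α β : ℝ) : Type := Lp ℂ 2 (hatMeasure n p α β)

/-- `⟨u, v⟩ = (1/p) ∑_{k<p} ∫_B u(e^{kπi/p} y) conj(v(e^{kπi/p} y)) |y|^α (1 - |y|²)^β dy`. -/
def hatInner {n p : ℕ} (α β : ℝ) (u v : hatB n p → ℂ) : ℂ :=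
  (1 / (p : ℂ)) * ∑ k : Fin p, ∫ y,
    u (rot k y) * (starRingEnd ℂ) (v (rot k y)) *
      ((weight α β (y : EuclideanSpace ℝ (Fin n)) : ℝ) : ℂ) ∂(ballVolume n)

/-- The weighted polyharmonic Bergman space, as a set of functions on the union of rotated balls:
the square integrable extensions of the functions that are polyharmonic of order `p` on `B`. -/
def bergman (n p : ℕ) (α β : ℝ) : Set (hatB n p → ℂ) :=
  {w | (∃ u : EuclideanSpace ℝ (Fin n) → ℂ, IsPolyharmonicOn p u (unitBall n) ∧
    IsRotExtension u w) ∧ MemLp w 2 (hatMeasure n p α β)}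

/-- The weighted polyharmonic Bergman space, as a set of elements of `L²`. -/
def bergmanL2 (n p : ℕ) (α β : ℝ) : Set (HatL2 n p α β) :=
  {f | ∃ w ∈ bergman n p α β, f =ᵐ[hatMeasure n p α β] w}

end

/-! ### Iterated Laplacians and integration by parts -/

section LaplacianBasics

open Laplacian Filter Topology
open scoped ContDiff

variable {E : Type*} [NormedAddCommGroup E] [InnerProductSpace ℝ E] [FiniteDimensional ℝ E]

/-! Everything rests on one integral formula, `exists_evaluationKernel`: at rotated points `e^{iψ}
x` with `|x| < a < 1`, the extension of a polyharmonic function u equals `∫ K(z, y) u(y) dy`. Here K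
is smooth and vanishes unless y lies in a real annulus `r ≤ |y| ≤ R` with `0 < r` and `R < 1`.

To obtain it, take a fundamental solution of `Δ^p` of the form `G(|y|²)`, where `G(w) = w^(p - n/2)
(A + B log w)` is holomorphic on the slit plane (`exists_fundamentalSolution`). If χ is a radial
cut-off equal to 1 near x, then `u(x) = ∫ G(|x - y|²) Δ^p(χu)(y) dy`, and the source `Δ^p(χu)` lives
on an annulus further out. Replacing `|x - y|²` by `∑ (z_i - y_i)²` continues the right side
holomorphically to all z for which this sum avoids the cut. Such z form an open star-shaped set
containing every rotation of the smaller ball (`lieDomain`). This proves the existence of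
extensions. Uniqueness is the identity theorem on the discs `c ↦ c x`, `|c| ≤ 1`. Cutting off the
singularity of the kernel and moving `Δ^p` onto it gives K.

On the annulus the weight has a positive lower bound, so the summand k = 0 of the norm already
controls the integral: point evaluations at all points of the rotated balls are bounded in the L²
norm (`exists_norm_le_of_mem_bergman`). Hence elements that agree almost everywhere are equal, and
an L²-convergent sequence in the space converges at every point. The pointwise limit inherits the
integral formula and is therefore smooth on B. It is polyharmonic in the weak sense, hence
classically, and so extends. The formula identifies this extension with the limit on every rotated
ball (`mem_bergman_of_tendsto`). This is closedness, and Riesz representation of the evaluations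
yields the kernel. -/

theorem laplacian_eq_sum_fderiv {ι : Type*} [Fintype ι] (v : OrthonormalBasis ι ℝ E)
    {f : E → ℂ} {x : E} (hf : ContDiffAt ℝ 2 f x) :
    Δ f x = ∑ i, fderiv ℝ (fun y => fderiv ℝ f y (v i)) x (v i) := by
  rw [InnerProductSpace.laplacian_eq_iteratedFDeriv_orthonormalBasis f v]
  refine Finset.sum_congr rfl fun i _ => ?_
  have h1 : DifferentiableAt ℝ (fderiv ℝ f) x :=
    (hf.fderiv_right (m := 1) (by norm_num)).differentiableAt (by norm_num)
  rw [iteratedFDeriv_two_apply]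
  simp [fderiv_clm_apply h1 (differentiableAt_const _)]

theorem ContDiffOn.laplacian_of_isOpen {f : E → ℂ} {s : Set E} (hs : IsOpen s)
    (hf : ContDiffOn ℝ ∞ f s) : ContDiffOn ℝ ∞ (Δ f) s := by
  have h : ∀ x ∈ s, Δ f x = ∑ i, fderiv ℝ (fun y => fderiv ℝ f y (stdOrthonormalBasis ℝ E i)) x
      (stdOrthonormalBasis ℝ E i) := fun x hx =>
    laplacian_eq_sum_fderiv _ ((hf.contDiffAt (hs.mem_nhds hx)).of_le (by norm_cast))
  refine ContDiffOn.congr (ContDiffOn.sum fun i _ => ?_) h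
  have h1 : ContDiffOn ℝ ∞ (fun y => fderiv ℝ f y (stdOrthonormalBasis ℝ E i)) s :=
    (hf.fderiv_of_isOpen hs (by norm_cast)).clm_apply contDiffOn_const
  exact (h1.fderiv_of_isOpen hs (by norm_cast)).clm_apply contDiffOn_const

theorem ContDiff.laplacian {f : E → ℂ} (hf : ContDiff ℝ ∞ f) : ContDiff ℝ ∞ (Δ f) :=
  contDiffOn_univ.1 (ContDiffOn.laplacian_of_isOpen isOpen_univ hf.contDiffOn)

theorem ContDiffOn.iterate_laplacian {f : E → ℂ} {s : Set E} (hs : IsOpen s)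
    (hf : ContDiffOn ℝ ∞ f s) (p : ℕ) :
    ContDiffOn ℝ ∞ ((fun v : E → ℂ => Δ v)^[p] f) s := by
  induction p with
  | zero => exact hf
  | succ p ih =>
    rw [Function.iterate_succ_apply']
    exact ih.laplacian_of_isOpen hs

theorem ContDiff.iterate_laplacian {f : E → ℂ} (hf : ContDiff ℝ ∞ f) (p : ℕ) :
    ContDiff ℝ ∞ ((fun v : E → ℂ => Δ v)^[p] f) :=
  contDiffOn_univ.1 (hf.contDiffOn.iterate_laplacian isOpen_univ p)

theorem Filter.EventuallyEq.iterate_laplacian {f g : E → ℂ} {x : E} (h : f =ᶠ[𝓝 x] g) (p : ℕ) :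
    (fun v : E → ℂ => Δ v)^[p] f =ᶠ[𝓝 x] (fun v : E → ℂ => Δ v)^[p] g := by
  induction p with
  | zero => exact h
  | succ p ih =>
    rw [Function.iterate_succ_apply', Function.iterate_succ_apply']
    exact InnerProductSpace.laplacian_congr_nhds ih

theorem iterate_laplacian_zero (p : ℕ) : (fun v : E → ℂ => Δ v)^[p] 0 = 0 := by
  induction p with
  | zero => rfl
  | succ p ih =>
    rw [Function.iterate_succ_apply', ih]
    exact InnerProductSpace.laplacian_const

theorem tsupport_iterate_laplacian_subset (f : E → ℂ) (p : ℕ) :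
    tsupport ((fun v : E → ℂ => Δ v)^[p] f) ⊆ tsupport f := by
  intro x hx
  by_contra h
  rw [notMem_tsupport_iff_eventuallyEq] at h
  refine (notMem_tsupport_iff_eventuallyEq.2 ?_) hx
  simpa [iterate_laplacian_zero] using h.iterate_laplacian p

theorem HasCompactSupport.iterate_laplacian {f : E → ℂ} (hf : HasCompactSupport f) (p : ℕ) :
    HasCompactSupport ((fun v : E → ℂ => Δ v)^[p] f) :=
  hf.mono' ((subset_tsupport _).trans (tsupport_iterate_laplacian_subset f p))

theorem laplacian_comp_const_add (f : E → ℂ) (a : E) :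
    Δ (fun y => f (a + y)) = fun y => Δ f (a + y) := by
  ext y
  simp only [InnerProductSpace.laplacian_eq_iteratedFDeriv_stdOrthonormalBasis,
    iteratedFDeriv_comp_add_left]

theorem iterate_laplacian_comp_const_add (f : E → ℂ) (a : E) (p : ℕ) :
    (fun v : E → ℂ => Δ v)^[p] (fun y => f (a + y)) =
      fun y => (fun v : E → ℂ => Δ v)^[p] f (a + y) := by
  induction p with
  | zero => rfl
  | succ p ih =>
    rw [Function.iterate_succ_apply', Function.iterate_succ_apply', ih]
    exact laplacian_comp_const_add _ a

variable [MeasurableSpace E] [BorelSpace E]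

theorem integral_mul_fderiv_eq_neg {f g : E → ℂ} (hf : ContDiff ℝ 1 f) (hg : ContDiff ℝ 1 g)
    (h : HasCompactSupport f ∨ HasCompactSupport g) (v : E) :
    ∫ x, f x * fderiv ℝ g x v = -∫ x, fderiv ℝ f x v * g x := by
  have hf' : Continuous fun x => fderiv ℝ f x v :=
    (hf.continuous_fderiv one_ne_zero).clm_apply continuous_const
  have hg' : Continuous fun x => fderiv ℝ g x v :=
    (hg.continuous_fderiv one_ne_zero).clm_apply continuous_const
  refine integral_mul_fderiv_eq_neg_fderiv_mul_of_integrable ?_ ?_ ?_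
    (fun x _ => hf.differentiable one_ne_zero x) (fun x _ => hg.differentiable one_ne_zero x)
  · refine (hf'.mul hg.continuous).integrable_of_hasCompactSupport ?_
    exact h.elim (fun h => (h.fderiv_apply ℝ v).mul_right) fun h => h.mul_left
  · refine (hf.continuous.mul hg').integrable_of_hasCompactSupport ?_
    exact h.elim (fun h => h.mul_right) fun h => (h.fderiv_apply ℝ v).mul_left
  · refine (hf.continuous.mul hg.continuous).integrable_of_hasCompactSupport ?_
    exact h.elim (fun h => h.mul_right) fun h => h.mul_left

/-- Two integrations by parts in each direction of an orthonormal basis. Compact support of either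
factor makes every product integrable and removes boundary terms. -/
theorem integral_mul_laplacian_comm {f g : E → ℂ} (hf : ContDiff ℝ ∞ f) (hg : ContDiff ℝ ∞ g)
    (h : HasCompactSupport f ∨ HasCompactSupport g) :
    ∫ x, f x * Δ g x = ∫ x, Δ f x * g x := by
  let b := stdOrthonormalBasis ℝ E
  have hd : ∀ {k : E → ℂ}, ContDiff ℝ ∞ k → ∀ v, ContDiff ℝ ∞ fun y => fderiv ℝ k y v :=
    fun hk v => (hk.fderiv_right (by norm_cast)).clm_apply contDiff_const
  have h1 : ∀ {k : E → ℂ}, ContDiff ℝ ∞ k → ContDiff ℝ 1 k :=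
    fun hk => hk.of_le (by norm_cast)
  have hs : ∀ {k : E → ℂ}, ContDiff ℝ ∞ k → ∀ x, Δ k x =
      ∑ i, fderiv ℝ (fun y => fderiv ℝ k y (b i)) x (b i) := fun hk x =>
    laplacian_eq_sum_fderiv b (hk.contDiffAt.of_le (by norm_cast))
  simp only [hs hf, hs hg, Finset.mul_sum, Finset.sum_mul]
  rw [integral_finsetSum, integral_finsetSum]
  · refine Finset.sum_congr rfl fun i _ => ?_
    rw [integral_mul_fderiv_eq_neg (h1 hf) (h1 (hd hg _)) (h.imp_right fun h => h.fderiv_apply ℝ _)]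
    exact neg_eq_iff_eq_neg.2 (integral_mul_fderiv_eq_neg (h1 (hd hf _)) (h1 hg)
      (h.imp_left fun h => h.fderiv_apply ℝ _) _)
  · intro i _
    refine ((hd (hd hf _) _).continuous.mul hg.continuous).integrable_of_hasCompactSupport ?_
    exact h.elim (fun h => ((h.fderiv_apply ℝ _).fderiv_apply ℝ _).mul_right) fun h => h.mul_left
  · intro i _
    refine (hf.continuous.mul (hd (hd hg _) _).continuous).integrable_of_hasCompactSupport ?_
    exact h.elim (fun h => h.mul_right) fun h => ((h.fderiv_apply ℝ _).fderiv_apply ℝ _).mul_left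

theorem integral_mul_iterate_laplacian_comm {f g : E → ℂ} (hf : ContDiff ℝ ∞ f)
    (hg : ContDiff ℝ ∞ g) (h : HasCompactSupport f ∨ HasCompactSupport g) (p : ℕ) :
    ∫ x, f x * (fun v : E → ℂ => Δ v)^[p] g x = ∫ x, (fun v : E → ℂ => Δ v)^[p] f x * g x := by
  induction p generalizing f with
  | zero => rfl
  | succ p ih =>
    -- The outermost Laplacian leaves g and becomes the innermost one on f, which is why the
    -- induction runs over all f.
    rw [Function.iterate_succ_apply', Function.iterate_succ_apply,
      integral_mul_laplacian_comm hf (hg.iterate_laplacian p)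
        (h.imp_right fun h => h.iterate_laplacian p)]
    exact ih hf.laplacian (h.imp_left fun h => h.iterate_laplacian 1)

end LaplacianBasics

/-! ### Radial functions with a logarithm, and an integrable majorant -/

section FundamentalSolution

open Laplacian Filter Topology Module
open scoped ContDiff

/-- The function `w ↦ w ^ a * (A + B * log w)`. -/
noncomputable def logPow (a A B : ℝ) (w : ℂ) : ℂ := w ^ (a : ℂ) * (A + B * Complex.log w)

/-- The family is closed under differentiation, so applying Δ to a radial function becomes linear
algebra in the pair (A, B). The logarithm is needed because powers alone have no primitive at
exponent -1. -/
theorem hasDerivAt_logPow (a A B : ℝ) {w : ℂ} (hw : w ∈ Complex.slitPlane) :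
    HasDerivAt (logPow a A B) (logPow (a - 1) (a * A + B) (a * B) w) w := by
  have h0 : w ≠ 0 := Complex.slitPlane_ne_zero hw
  have h1 : HasDerivAt (fun w : ℂ => w ^ (a : ℂ)) (a * w ^ ((a : ℂ) - 1)) w := by
    simpa using (hasDerivAt_id w).cpow_const (c := (a : ℂ)) hw
  have h2 : HasDerivAt (fun w => (A : ℂ) + B * Complex.log w) (B * w⁻¹) w :=
    ((Complex.hasDerivAt_log hw).const_mul _).const_add _
  refine (h1.mul h2).congr_deriv ?_
  simp only [logPow, Complex.ofReal_sub, Complex.ofReal_one, Complex.ofReal_add,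
    Complex.ofReal_mul, Complex.cpow_sub _ _ h0, Complex.cpow_one]
  field_simp
  ring

theorem analyticOnNhd_logPow (a A B : ℝ) : AnalyticOnNhd ℂ (logPow a A B) Complex.slitPlane :=
  DifferentiableOn.analyticOnNhd
    (fun _ hw => (hasDerivAt_logPow a A B hw).differentiableAt.differentiableWithinAt)
    Complex.isOpen_slitPlane

theorem mul_logPow_sub_one (a A B : ℝ) {w : ℂ} (hw : w ≠ 0) :
    w * logPow (a - 1) A B w = logPow a A B w := by
  simp only [logPow, Complex.ofReal_sub, Complex.ofReal_one, Complex.cpow_sub _ _ hw,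
    Complex.cpow_one]
  field_simp

theorem norm_logPow_ofReal (a A B : ℝ) {w : ℝ} (hw : 0 < w) :
    ‖logPow a A B w‖ = w ^ a * |A + B * Real.log w| := by
  rw [logPow, norm_mul, Complex.norm_cpow_eq_rpow_re_of_pos hw, ← Complex.ofReal_log hw.le]
  norm_cast

/-- The logarithm costs half a power on either side: `|log w| ≤ 2 w^(1/2) + 2 w^(-1/2)`. The
condition on `a + c` keeps the remaining exponents nonnegative, hence the powers bounded up to R. -/
theorem exists_norm_logPow_le (a A B R : ℝ) {c : ℝ} (hc : 1 / 2 ≤ a + c) :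
    ∃ C, 0 ≤ C ∧ ∀ w : ℝ, 0 < w → w ≤ R → ‖logPow a A B w‖ ≤ C * w ^ (-c) := by
  rcases le_or_gt R 0 with hR | hR
  · exact ⟨0, le_rfl, fun w h1 h2 => absurd (h1.trans_le h2) hR.not_gt⟩
  refine ⟨|A| * R ^ (a + c) + |B| * (2 * R ^ (a + c + 1 / 2) + 2 * R ^ (a + c - 1 / 2)),
    by positivity, fun w hw hwR => ?_⟩
  have hlog : |Real.log w| ≤ 2 * w ^ (1 / 2 : ℝ) + 2 * w ^ (-(1 / 2) : ℝ) := by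
    have h1 := Real.log_le_rpow_div hw.le (ε := 1 / 2) (by norm_num)
    have h2 := Real.log_le_rpow_div (inv_pos.2 hw).le (ε := 1 / 2) (by norm_num)
    rw [Real.log_inv, Real.inv_rpow hw.le, ← Real.rpow_neg hw.le] at h2
    have h3 := Real.rpow_pos_of_pos hw (1 / 2)
    have h4 := Real.rpow_pos_of_pos hw (-(1 / 2))
    rw [abs_le]
    constructor <;> linarith
  have hsplit : w ^ a = w ^ (a + c) * w ^ (-c) := by rw [← Real.rpow_add hw]; ring_nf
  rw [norm_logPow_ofReal _ _ _ hw, hsplit, mul_right_comm]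
  refine mul_le_mul_of_nonneg_right ?_ (Real.rpow_nonneg hw.le _)
  calc w ^ (a + c) * |A + B * Real.log w|
      ≤ w ^ (a + c) * (|A| + |B| * (2 * w ^ (1 / 2 : ℝ) + 2 * w ^ (-(1 / 2) : ℝ))) := by
        refine mul_le_mul_of_nonneg_left ?_ (Real.rpow_nonneg hw.le _)
        refine (abs_add_le _ _).trans ?_
        rw [abs_mul]
        gcongr
    _ = |A| * w ^ (a + c) + |B| * (2 * w ^ (a + c + 1 / 2) + 2 * w ^ (a + c - 1 / 2)) := by
        rw [Real.rpow_add hw (a + c) (1 / 2), sub_eq_add_neg, Real.rpow_add hw (a + c) (-(1 / 2))]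
        ring
    _ ≤ _ := by
        have h5 : 0 ≤ a + c - 1 / 2 := by linarith
        gcongr

variable {E : Type*} [NormedAddCommGroup E] [InnerProductSpace ℝ E]

theorem contDiff_comp_norm_sq_add {G : ℂ → ℂ} (hG : AnalyticOnNhd ℂ G Complex.slitPlane)
    {s : ℝ} (hs : 0 < s) : ContDiff ℝ ∞ fun y : E => G ((‖y‖ ^ 2 + s : ℝ)) := by
  have h1 : ContDiffOn ℝ ∞ G Complex.slitPlane :=
    (hG.contDiffOn (n := ∞) Complex.isOpen_slitPlane.uniqueDiffOn).restrict_scalars ℝ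
  have h2 : ContDiff ℝ ∞ fun y : E => ((‖y‖ ^ 2 + s : ℝ) : ℂ) :=
    Complex.ofRealCLM.contDiff.comp ((contDiff_norm_sq ℝ).add contDiff_const)
  exact h1.comp_contDiff h2 fun y => Complex.ofReal_mem_slitPlane.2 (by positivity)

variable [FiniteDimensional ℝ E]

/-- The shift s > 0 keeps the argument away from the branch point, so the radial formula holds at
every y, including the origin. -/
theorem laplacian_comp_norm_sq_add {G G' G'' : ℂ → ℂ}
    (h1 : ∀ w ∈ Complex.slitPlane, HasDerivAt G (G' w) w)
    (h2 : ∀ w ∈ Complex.slitPlane, HasDerivAt G' (G'' w) w)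
    {s : ℝ} (hs : 0 < s) (y : E) (hG : ContDiff ℝ 2 fun y : E => G ((‖y‖ ^ 2 + s : ℝ))) :
    Δ (fun y : E => G ((‖y‖ ^ 2 + s : ℝ))) y =
      4 * ‖y‖ ^ 2 * G'' ((‖y‖ ^ 2 + s : ℝ)) + 2 * finrank ℝ E * G' ((‖y‖ ^ 2 + s : ℝ)) := by
  have hslit : ∀ y : E, ((‖y‖ ^ 2 + s : ℝ) : ℂ) ∈ Complex.slitPlane := fun y =>
    Complex.ofReal_mem_slitPlane.2 (by positivity)
  have hnorm : ∀ y : E, HasFDerivAt (fun y : E => ‖y‖ ^ 2 + s) (2 • innerSL ℝ y) y := fun y =>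
    (hasStrictFDerivAt_norm_sq y).hasFDerivAt.add_const s
  have hcomp : ∀ {H H' : ℂ → ℂ}, (∀ w ∈ Complex.slitPlane, HasDerivAt H (H' w) w) → ∀ y : E,
      HasFDerivAt (fun y : E => H ((‖y‖ ^ 2 + s : ℝ)))
        ((2 • innerSL ℝ y : E →L[ℝ] ℝ).smulRight (H' ((‖y‖ ^ 2 + s : ℝ)))) y := by
    intro H H' hH y
    exact (hH _ (hslit y)).comp_ofReal.hasFDerivAt.comp y (hnorm y)
  have hd : ∀ y v : E, fderiv ℝ (fun y : E => G ((‖y‖ ^ 2 + s : ℝ))) y v =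
      ((2 * inner ℝ y v : ℝ) : ℂ) * G' ((‖y‖ ^ 2 + s : ℝ)) := by
    intro y v
    rw [(hcomp h1 y).fderiv]
    simp
  have hd2 : ∀ v : E, fderiv ℝ (fun y : E => fderiv ℝ (fun y : E => G ((‖y‖ ^ 2 + s : ℝ))) y v)
      y v = 4 * ((inner ℝ y v * inner ℝ v y : ℝ) : ℂ) * G'' ((‖y‖ ^ 2 + s : ℝ)) +
        2 * ((‖v‖ ^ 2 : ℝ) : ℂ) * G' ((‖y‖ ^ 2 + s : ℝ)) := by
    intro v
    simp only [hd]
    have h3 : HasFDerivAt (fun y : E => ((2 * inner ℝ y v : ℝ) : ℂ))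
        (Complex.ofRealCLM.comp ((2 : ℝ) • innerSL ℝ v)) y := by
      have : (fun y : E => ((2 * inner ℝ y v : ℝ) : ℂ)) =
          Complex.ofRealCLM.comp ((2 : ℝ) • innerSL ℝ v) := by
        ext y; simp [real_inner_comm]
      rw [this]
      exact ContinuousLinearMap.hasFDerivAt _
    rw [(h3.fun_mul (hcomp h2 y)).fderiv]
    simp [real_inner_comm v y]
    ring
  rw [laplacian_eq_sum_fderiv (stdOrthonormalBasis ℝ E) hG.contDiffAt]
  simp only [hd2, Finset.sum_add_distrib, ← Finset.sum_mul, ← Finset.mul_sum,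
    ← Complex.ofReal_sum, (stdOrthonormalBasis ℝ E).sum_inner_mul_inner]
  simp [(stdOrthonormalBasis ℝ E).orthonormal.1]

variable [MeasurableSpace E] [BorelSpace E]

/-- In polar coordinates the Jacobian `r^(n-1)` cancels the power exactly. This gives the majorant
for the limits ε → 0 below. -/
theorem integrableOn_norm_rpow_ball [Nontrivial E] (R : ℝ) :
    IntegrableOn (fun y : E => ‖y‖ ^ (-((finrank ℝ E : ℝ) - 1))) (Metric.ball 0 R) := by
  rw [← integrable_indicator_iff Metric.isOpen_ball.measurableSet]
  have h : (Metric.ball (0 : E) R).indicator (fun y : E => ‖y‖ ^ (-((finrank ℝ E : ℝ) - 1))) =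
      fun y => (Set.Iio R).indicator (fun r : ℝ => r ^ (-((finrank ℝ E : ℝ) - 1))) ‖y‖ := by
    ext y
    simp [Set.indicator]
  rw [h, integrable_fun_norm_addHaar]
  have h2 : Set.EqOn (fun y : ℝ => y ^ (finrank ℝ E - 1) •
      (Set.Iio R).indicator (fun r : ℝ => r ^ (-((finrank ℝ E : ℝ) - 1))) y)
      ((Set.Iio R).indicator 1) (Set.Ioi 0) := by
    intro r hr
    by_cases hR : r < R
    · have h3 : ((finrank ℝ E - 1 : ℕ) : ℝ) = (finrank ℝ E : ℝ) - 1 := by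
        rw [Nat.cast_sub finrank_pos]; simp
      simp only [Set.mem_Iio, hR, Set.indicator_of_mem, smul_eq_mul, Pi.one_apply]
      rw [← Real.rpow_natCast, ← Real.rpow_add hr, h3]
      simp
    · simp [hR]
  rw [integrableOn_congr_fun h2 measurableSet_Ioi, integrableOn_indicator_iff measurableSet_Iio,
    Set.Iio_inter_Ioi]
  exact integrableOn_const (by simp)

theorem integrable_norm_rpow_mul_norm [Nontrivial E] {φ : E → ℂ} (hφ : Continuous φ)
    (hc : HasCompactSupport φ) :
    Integrable fun y : E => ‖y‖ ^ (-((finrank ℝ E : ℝ) - 1)) * ‖φ y‖ := by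
  obtain ⟨R, hR⟩ := hc.isBounded.subset_ball 0
  obtain ⟨M, hM⟩ := hφ.bounded_above_of_compact_support hc
  have h1 : IntegrableOn (fun y : E => ‖y‖ ^ (-((finrank ℝ E : ℝ) - 1)) * ‖φ y‖)
      (Metric.ball 0 R) :=
    (integrableOn_norm_rpow_ball R).mul_bdd (c := M) hφ.norm.aestronglyMeasurable
      (Eventually.of_forall fun x => by simpa using hM x)
  refine (integrableOn_iff_integrable_of_support_subset ?_).1 h1
  intro y hy
  refine hR (subset_tsupport _ ?_)
  simp only [Function.mem_support] at hy ⊢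
  exact fun h => hy (by simp [h])

end FundamentalSolution

/-! ### Removing the regularisation `|y|² + ε²` -/

section FundamentalSolutionLimits

open Laplacian Filter Topology Module
open scoped ContDiff

variable {E : Type*} [NormedAddCommGroup E]

theorem tendsto_logPow_norm_sq_add (a A B : ℝ) {y : E} (hy : y ≠ 0) :
    Tendsto (fun ε : ℝ => logPow a A B ((‖y‖ ^ 2 + ε ^ 2 : ℝ))) (𝓝[>] 0)
      (𝓝 (logPow a A B ((‖y‖ ^ 2 : ℝ)))) := by
  have hy0 : 0 < ‖y‖ := norm_pos_iff.2 hy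
  have h1 : ContinuousAt (logPow a A B) ((‖y‖ ^ 2 : ℝ)) :=
    (hasDerivAt_logPow a A B (Complex.ofReal_mem_slitPlane.2 (by positivity))).continuousAt
  have h2 : Tendsto (fun ε : ℝ => ((‖y‖ ^ 2 + ε ^ 2 : ℝ) : ℂ)) (𝓝 0) (𝓝 ((‖y‖ ^ 2 : ℝ))) := by
    have : Continuous fun ε : ℝ => ((‖y‖ ^ 2 + ε ^ 2 : ℝ) : ℂ) := by fun_prop
    simpa using this.tendsto 0
  exact h1.tendsto.comp (h2.mono_left nhdsWithin_le_nhds)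

variable [InnerProductSpace ℝ E]

theorem continuous_logPow_norm_sq_add (a A B : ℝ) {ε : ℝ} (hε : 0 < ε) :
    Continuous fun y : E => logPow a A B ((‖y‖ ^ 2 + ε ^ 2 : ℝ)) :=
  (contDiff_comp_norm_sq_add (analyticOnNhd_logPow a A B) (by positivity)).continuous

variable [FiniteDimensional ℝ E]

/-- With `c = (n - 1)/2` the bound for `logPow` becomes `(|y|² + ε²)^(-c) ≤ |y|^(-(n-1))`, uniformly
in ε; the assumption on a is exactly `1/2 ≤ a + c`. -/
theorem exists_norm_logPow_norm_sq_add_le {φ : E → ℂ} (hc : HasCompactSupport φ) {a : ℝ}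
    (A B : ℝ) (ha : 1 - (finrank ℝ E : ℝ) / 2 ≤ a) :
    ∃ C, ∀ ε : ℝ, ε ≤ 1 → 0 < ε → ∀ y : E, y ≠ 0 →
      ‖logPow a A B ((‖y‖ ^ 2 + ε ^ 2 : ℝ))‖ * ‖φ y‖ ≤
        C * (‖y‖ ^ (-((finrank ℝ E : ℝ) - 1)) * ‖φ y‖) := by
  obtain ⟨R, hR⟩ := hc.isBounded.subset_ball 0
  by_cases hn : finrank ℝ E = 0
  · refine ⟨0, fun ε _ _ y hy => absurd ?_ hy⟩
    have := finrank_zero_iff.1 hn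
    exact Subsingleton.elim _ _
  obtain ⟨C, hC, h⟩ := exists_norm_logPow_le a A B (R ^ 2 + 1)
    (c := ((finrank ℝ E : ℝ) - 1) / 2) (by linarith)
  have hn1 : (1 : ℝ) ≤ finrank ℝ E := by exact_mod_cast Nat.one_le_iff_ne_zero.2 hn
  refine ⟨C, fun ε h1 h0 y hy => ?_⟩
  rw [← mul_assoc]
  by_cases hφ : φ y = 0
  · simp [hφ]
  refine mul_le_mul_of_nonneg_right ?_ (norm_nonneg _)
  have hyR : ‖y‖ < R := by simpa using hR (subset_tsupport φ hφ)
  have hy0 : 0 < ‖y‖ := norm_pos_iff.2 hy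
  refine (h _ (by positivity) ?_).trans ?_
  · gcongr
    nlinarith
  · refine mul_le_mul_of_nonneg_left ?_ hC
    calc (‖y‖ ^ 2 + ε ^ 2) ^ (-(((finrank ℝ E : ℝ) - 1) / 2))
        ≤ (‖y‖ ^ 2) ^ (-(((finrank ℝ E : ℝ) - 1) / 2)) :=
          Real.rpow_le_rpow_of_nonpos (by positivity) (by nlinarith) (by linarith)
      _ = ‖y‖ ^ (-((finrank ℝ E : ℝ) - 1)) := by
          rw [← Real.rpow_natCast, ← Real.rpow_mul hy0.le]
          congr 1
          push_cast
          ring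

/-- Writing `4|y|² = 4(|y|² + ε²) - 4ε²` splits the Laplacian into a term of the same family with
exponent a - 1 and an error carrying the factor ε². -/
theorem laplacian_logPow_norm_sq_add (a A B : ℝ) {ε : ℝ} (hε : 0 < ε) (y : E) :
    Δ (fun y : E => logPow a A B ((‖y‖ ^ 2 + ε ^ 2 : ℝ))) y =
      logPow (a - 1) (4 * ((a - 1) * (a * A + B) + a * B) + 2 * finrank ℝ E * (a * A + B))
        (4 * ((a - 1) * (a * B)) + 2 * finrank ℝ E * (a * B)) ((‖y‖ ^ 2 + ε ^ 2 : ℝ)) -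
      4 * (((ε ^ 2 : ℝ) : ℂ) * logPow (a - 1 - 1) ((a - 1) * (a * A + B) + a * B)
        ((a - 1) * (a * B)) ((‖y‖ ^ 2 + ε ^ 2 : ℝ))) := by
  have hε2 : 0 < ε ^ 2 := by positivity
  have h0 : ((‖y‖ ^ 2 + ε ^ 2 : ℝ) : ℂ) ≠ 0 := by exact_mod_cast (by positivity)
  rw [laplacian_comp_norm_sq_add (fun w hw => hasDerivAt_logPow a A B hw)
    (fun w hw => hasDerivAt_logPow _ _ _ hw) hε2 y
    ((contDiff_comp_norm_sq_add (analyticOnNhd_logPow a A B) hε2).of_le (by norm_cast))]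
  have h1 := mul_logPow_sub_one (a - 1) ((a - 1) * (a * A + B) + a * B) ((a - 1) * (a * B)) h0
  have h2 : logPow (a - 1) (4 * ((a - 1) * (a * A + B) + a * B) + 2 * finrank ℝ E * (a * A + B))
        (4 * ((a - 1) * (a * B)) + 2 * finrank ℝ E * (a * B)) ((‖y‖ ^ 2 + ε ^ 2 : ℝ)) =
      4 * logPow (a - 1) ((a - 1) * (a * A + B) + a * B) ((a - 1) * (a * B))
        ((‖y‖ ^ 2 + ε ^ 2 : ℝ)) +
      2 * finrank ℝ E * logPow (a - 1) (a * A + B) (a * B) ((‖y‖ ^ 2 + ε ^ 2 : ℝ)) := by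
    simp only [logPow]
    push_cast
    ring
  rw [h2, ← h1]
  push_cast
  ring

variable [MeasurableSpace E] [BorelSpace E] [Nontrivial E]

theorem ae_ne_zero : ∀ᵐ y : E, y ≠ 0 :=
  compl_mem_ae_iff.2 (measure_singleton 0)

theorem eventually_pos_le_one : ∀ᶠ ε : ℝ in 𝓝[>] 0, 0 < ε ∧ ε ≤ 1 := by
  filter_upwards [Ioc_mem_nhdsGT (zero_lt_one (α := ℝ))] with ε hε using hε

theorem tendsto_integral_logPow_norm_sq_add {φ : E → ℂ} (hφ : Continuous φ)
    (hc : HasCompactSupport φ) {a : ℝ} (A B : ℝ) (ha : 1 - (finrank ℝ E : ℝ) / 2 ≤ a) :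
    Tendsto (fun ε : ℝ => ∫ y : E, logPow a A B ((‖y‖ ^ 2 + ε ^ 2 : ℝ)) * φ y) (𝓝[>] 0)
      (𝓝 (∫ y : E, logPow a A B ((‖y‖ ^ 2 : ℝ)) * φ y)) := by
  obtain ⟨C, hC⟩ := exists_norm_logPow_norm_sq_add_le hc A B ha
  refine tendsto_integral_filter_of_dominated_convergence
    (fun y => C * (‖y‖ ^ (-((finrank ℝ E : ℝ) - 1)) * ‖φ y‖)) ?_ ?_
    ((integrable_norm_rpow_mul_norm hφ hc).const_mul C) ?_
  · filter_upwards [eventually_pos_le_one] with ε hε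
    exact ((continuous_logPow_norm_sq_add a A B hε.1).mul hφ).aestronglyMeasurable
  · filter_upwards [eventually_pos_le_one] with ε hε
    filter_upwards [ae_ne_zero] with y hy
    rw [norm_mul]
    exact hC ε hε.2 hε.1 y hy
  · filter_upwards [ae_ne_zero] with y hy
    exact (tendsto_logPow_norm_sq_add a A B hy).mul_const _

/-- Since `ε² ≤ |y|² + ε²`, the factor ε² raises the exponent back to a in the majorant, while
pointwise the integrand tends to 0. -/
theorem tendsto_integral_sq_mul_logPow_norm_sq_add {φ : E → ℂ} (hφ : Continuous φ)
    (hc : HasCompactSupport φ) {a : ℝ} (A B : ℝ) (ha : 1 - (finrank ℝ E : ℝ) / 2 ≤ a) :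
    Tendsto (fun ε : ℝ => ∫ y : E, ((ε ^ 2 : ℝ) : ℂ) *
      logPow (a - 1) A B ((‖y‖ ^ 2 + ε ^ 2 : ℝ)) * φ y) (𝓝[>] 0) (𝓝 0) := by
  obtain ⟨C, hC⟩ := exists_norm_logPow_norm_sq_add_le hc A B ha
  rw [← integral_zero E ℂ (μ := volume)]
  refine tendsto_integral_filter_of_dominated_convergence
    (fun y => C * (‖y‖ ^ (-((finrank ℝ E : ℝ) - 1)) * ‖φ y‖)) ?_ ?_
    ((integrable_norm_rpow_mul_norm hφ hc).const_mul C) ?_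
  · filter_upwards [eventually_pos_le_one] with ε hε
    exact ((continuous_const.mul (continuous_logPow_norm_sq_add _ A B hε.1)).mul
      hφ).aestronglyMeasurable
  · filter_upwards [eventually_pos_le_one] with ε hε
    filter_upwards [ae_ne_zero] with y hy
    rw [norm_mul]
    refine le_trans (mul_le_mul_of_nonneg_right ?_ (norm_nonneg _)) (hC ε hε.2 hε.1 y hy)
    have h0 : 0 < ‖y‖ ^ 2 + ε ^ 2 := by have := hε.1; positivity
    rw [← mul_logPow_sub_one a A B (w := ((‖y‖ ^ 2 + ε ^ 2 : ℝ) : ℂ)) (by exact_mod_cast h0.ne'),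
      norm_mul, norm_mul]
    refine mul_le_mul_of_nonneg_right ?_ (norm_nonneg _)
    rw [Complex.norm_real, Complex.norm_real, Real.norm_of_nonneg h0.le,
      Real.norm_of_nonneg (sq_nonneg ε)]
    nlinarith [sq_nonneg ‖y‖]
  · filter_upwards [ae_ne_zero] with y hy
    have h2 : Tendsto (fun ε : ℝ => ((ε ^ 2 : ℝ) : ℂ)) (𝓝[>] 0) (𝓝 0) := by
      have : Continuous fun ε : ℝ => ((ε ^ 2 : ℝ) : ℂ) := by fun_prop
      simpa using (this.tendsto 0).mono_left nhdsWithin_le_nhds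
    simpa using (h2.mul (tendsto_logPow_norm_sq_add (a - 1) A B hy)).mul_const (φ y)

/-- Above the critical exponent `1 - n/2` by at least one, the ε² error disappears in the limit and
no point mass arises: the classical Laplacian is also the distributional one. -/
theorem integral_logPow_mul_laplacian {φ : E → ℂ} (hφ : ContDiff ℝ ∞ φ)
    (hc : HasCompactSupport φ) {a : ℝ} (A B : ℝ) (ha : 2 - (finrank ℝ E : ℝ) / 2 ≤ a) :
    ∫ y : E, logPow a A B ((‖y‖ ^ 2 : ℝ)) * Δ φ y =
      ∫ y : E, logPow (a - 1)
        (4 * ((a - 1) * (a * A + B) + a * B) + 2 * finrank ℝ E * (a * A + B))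
        (4 * ((a - 1) * (a * B)) + 2 * finrank ℝ E * (a * B)) ((‖y‖ ^ 2 : ℝ)) * φ y := by
  have h1 := tendsto_integral_logPow_norm_sq_add hφ.laplacian.continuous
    (hc.iterate_laplacian 1) A B (by linarith : 1 - (finrank ℝ E : ℝ) / 2 ≤ a)
  have h2 := tendsto_integral_logPow_norm_sq_add hφ.continuous hc
    (4 * ((a - 1) * (a * A + B) + a * B) + 2 * finrank ℝ E * (a * A + B))
    (4 * ((a - 1) * (a * B)) + 2 * finrank ℝ E * (a * B))
    (by linarith : 1 - (finrank ℝ E : ℝ) / 2 ≤ a - 1)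
  have h3 := tendsto_integral_sq_mul_logPow_norm_sq_add hφ.continuous hc
    ((a - 1) * (a * A + B) + a * B) ((a - 1) * (a * B))
    (by linarith : 1 - (finrank ℝ E : ℝ) / 2 ≤ a - 1)
  have h4 := h2.sub (h3.const_mul 4)
  rw [mul_zero, sub_zero] at h4
  refine tendsto_nhds_unique h1 (h4.congr' ?_)
  filter_upwards [eventually_pos_le_one] with ε hε
  rw [integral_mul_laplacian_comm (contDiff_comp_norm_sq_add (analyticOnNhd_logPow a A B)
    (by have := hε.1; positivity)) hφ (Or.inr hc), ← integral_const_mul, ← integral_sub]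
  · refine integral_congr_ae (Eventually.of_forall fun y => ?_)
    simp only [laplacian_logPow_norm_sq_add a A B hε.1]
    ring
  · exact ((continuous_logPow_norm_sq_add _ _ _ hε.1).mul
      hφ.continuous).integrable_of_hasCompactSupport hc.mul_left
  · exact (continuous_const.mul ((continuous_const.mul (continuous_logPow_norm_sq_add _ _ _
      hε.1)).mul hφ.continuous)).integrable_of_hasCompactSupport hc.mul_left.mul_left

end FundamentalSolutionLimits

/-! ### The fundamental solution of `Δ^p` -/

section FundamentalSolutionExists

open Laplacian Filter Topology Module
open scoped ContDiff

variable {E : Type*} [NormedAddCommGroup E] [InnerProductSpace ℝ E] [FiniteDimensional ℝ E]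
  [MeasurableSpace E] [BorelSpace E]

/-- The kernel is `ε^(-n) k(y/ε)` with `k(x) = (1 + |x|²)^(-(n+2)/2)` integrable; substitute `y =
εx`. -/
theorem tendsto_integral_approxIdentity {φ : E → ℂ} (hφ : Continuous φ)
    (hc : HasCompactSupport φ) :
    Tendsto (fun ε : ℝ => ∫ y : E, ((ε ^ 2 * (‖y‖ ^ 2 + ε ^ 2) ^
      (-((finrank ℝ E : ℝ) + 2) / 2) : ℝ) : ℂ) * φ y) (𝓝[>] 0)
      (𝓝 (((∫ x : E, (1 + ‖x‖ ^ 2) ^ (-((finrank ℝ E : ℝ) + 2) / 2) : ℝ) : ℂ) * φ 0)) := by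
  have hint : Integrable fun x : E => ((1 : ℝ) + ‖x‖ ^ 2) ^ (-((finrank ℝ E : ℝ) + 2) / 2) :=
    integrable_rpow_neg_one_add_norm_sq (by linarith)
  obtain ⟨M, hM⟩ := hφ.bounded_above_of_compact_support hc
  have hk : ∀ x : E, 0 ≤ ((1 : ℝ) + ‖x‖ ^ 2) ^ (-((finrank ℝ E : ℝ) + 2) / 2) := fun x => by
    positivity
  have h1 : Tendsto (fun ε : ℝ => ∫ x : E,
      (((1 + ‖x‖ ^ 2) ^ (-((finrank ℝ E : ℝ) + 2) / 2) : ℝ) : ℂ) * φ (ε • x)) (𝓝[>] 0)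
      (𝓝 (∫ x : E, (((1 + ‖x‖ ^ 2) ^ (-((finrank ℝ E : ℝ) + 2) / 2) : ℝ) : ℂ) * φ 0)) := by
    refine tendsto_integral_filter_of_dominated_convergence
      (fun x => ((1 : ℝ) + ‖x‖ ^ 2) ^ (-((finrank ℝ E : ℝ) + 2) / 2) * M) ?_ ?_
      (hint.mul_const M) ?_
    · refine Eventually.of_forall fun ε => ?_
      exact hint.ofReal.aestronglyMeasurable.mul (by fun_prop)
    · refine Eventually.of_forall fun ε => Eventually.of_forall fun x => ?_
      rw [norm_mul, Complex.norm_real, Real.norm_of_nonneg (hk x)]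
      exact mul_le_mul_of_nonneg_left (hM _) (hk x)
    · refine Eventually.of_forall fun x => Tendsto.const_mul _ ?_
      have : Continuous fun ε : ℝ => φ (ε • x) := by fun_prop
      simpa using (this.tendsto 0).mono_left nhdsWithin_le_nhds
  rw [integral_mul_const, integral_complex_ofReal] at h1
  refine h1.congr' ?_
  filter_upwards [self_mem_nhdsWithin] with ε (hε : 0 < ε)
  have h2 := Measure.integral_comp_smul volume (fun y : E => ((ε ^ 2 * (‖y‖ ^ 2 + ε ^ 2) ^
      (-((finrank ℝ E : ℝ) + 2) / 2) : ℝ) : ℂ) * φ y) ε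
  have hpos : 0 < ε ^ finrank ℝ E := by positivity
  rw [abs_of_pos (inv_pos.2 hpos), eq_inv_smul_iff₀ hpos.ne'] at h2
  rw [← h2, ← integral_smul]
  refine integral_congr_ae (Eventually.of_forall fun x => ?_)
  have h3 : ‖ε • x‖ ^ 2 + ε ^ 2 = ε ^ 2 * (1 + ‖x‖ ^ 2) := by
    rw [norm_smul, Real.norm_of_nonneg hε.le]; ring
  have h4 : ε ^ finrank ℝ E * (ε ^ 2 * (ε ^ 2 * (1 + ‖x‖ ^ 2)) ^
      (-((finrank ℝ E : ℝ) + 2) / 2)) = (1 + ‖x‖ ^ 2) ^ (-((finrank ℝ E : ℝ) + 2) / 2) := by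
    rw [Real.mul_rpow (by positivity) (by positivity), ← mul_assoc, ← mul_assoc]
    nth_rw 3 [← Real.rpow_natCast]
    rw [← Real.rpow_mul hε.le, ← Real.rpow_natCast ε (finrank ℝ E), ← Real.rpow_natCast ε 2,
      ← Real.rpow_add hε, ← Real.rpow_add hε]
    have : (finrank ℝ E : ℝ) + (2 : ℕ) + (2 : ℕ) * (-((finrank ℝ E : ℝ) + 2) / 2) = 0 := by
      push_cast; ring
    rw [this, Real.rpow_zero, one_mul]
  simp only [h3, Complex.real_smul]
  rw [← mul_assoc, ← Complex.ofReal_mul, h4]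

variable [Nontrivial E]

theorem integral_japaneseBracket_pos :
    0 < ∫ x : E, ((1 : ℝ) + ‖x‖ ^ 2) ^ (-((finrank ℝ E : ℝ) + 2) / 2) := by
  have hint : Integrable fun x : E => ((1 : ℝ) + ‖x‖ ^ 2) ^ (-((finrank ℝ E : ℝ) + 2) / 2) :=
    integrable_rpow_neg_one_add_norm_sq (by linarith)
  have hk : ∀ x : E, 0 < ((1 : ℝ) + ‖x‖ ^ 2) ^ (-((finrank ℝ E : ℝ) + 2) / 2) := fun x => by
    positivity
  rw [integral_pos_iff_support_of_nonneg (fun x => (hk x).le) hint]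
  have : Function.support (fun x : E => ((1 : ℝ) + ‖x‖ ^ 2) ^ (-((finrank ℝ E : ℝ) + 2) / 2)) =
      Set.univ := Set.eq_univ_of_forall fun x => (hk x).ne'
  rw [this]
  exact Measure.measure_univ_pos.2 (NeZero.ne _)

/-- The conditions on A and B say that the derivative of the radial profile is `w^(-n/2)`. The main
terms of the Laplacian then cancel, and the ε² error is exactly 2n times the approximate identity,
which produces the point mass. -/
theorem integral_logPow_mul_laplacian_of_deriv {φ : E → ℂ} (hφ : ContDiff ℝ ∞ φ)
    (hc : HasCompactSupport φ) {a A B : ℝ} (ha : a = 1 - (finrank ℝ E : ℝ) / 2)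
    (hA : a * A + B = 1) (hB : a * B = 0) :
    ∫ y : E, logPow a A B ((‖y‖ ^ 2 : ℝ)) * Δ φ y =
      ((2 * finrank ℝ E * ∫ x : E, ((1 : ℝ) + ‖x‖ ^ 2) ^ (-((finrank ℝ E : ℝ) + 2) / 2) : ℝ) : ℂ) *
        φ 0 := by
  have h1 := tendsto_integral_logPow_norm_sq_add hφ.laplacian.continuous
    (hc.iterate_laplacian 1) A B ha.ge
  have h2 := (tendsto_integral_approxIdentity hφ.continuous hc).const_mul
    ((2 * finrank ℝ E : ℝ) : ℂ)
  rw [← mul_assoc, ← Complex.ofReal_mul] at h2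
  refine tendsto_nhds_unique h1 (h2.congr' ?_)
  filter_upwards [self_mem_nhdsWithin] with ε (hε : 0 < ε)
  rw [integral_mul_laplacian_comm (contDiff_comp_norm_sq_add (analyticOnNhd_logPow a A B)
    (by positivity)) hφ (Or.inr hc), ← integral_const_mul]
  refine integral_congr_ae (Eventually.of_forall fun y => ?_)
  have hw : 0 < ‖y‖ ^ 2 + ε ^ 2 := by positivity
  simp only [laplacian_logPow_norm_sq_add a A B hε, hA, hB]
  have h3 : a - 1 = -(finrank ℝ E : ℝ) / 2 := by rw [ha]; ring
  have h4 : -(finrank ℝ E : ℝ) / 2 - 1 = -((finrank ℝ E : ℝ) + 2) / 2 := by ring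
  have h5 : 4 * (-(finrank ℝ E : ℝ) / 2 * 1 + 0) + 2 * (finrank ℝ E : ℝ) * 1 = 0 := by ring
  rw [h3, h4, h5]
  simp only [logPow, mul_zero, add_zero, Complex.ofReal_zero, zero_mul, mul_one]
  rw [← Complex.ofReal_cpow hw.le]
  push_cast
  ring

/-- The operator `Δ ^ p` has a fundamental solution of the form
`|y| ^ (2p - n) * (A + B * log |y|²)`. -/
theorem exists_fundamentalSolution (p : ℕ) (hp : 1 ≤ p) :
    ∃ A B : ℝ, ∀ φ : E → ℂ, ContDiff ℝ ∞ φ → HasCompactSupport φ →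
      ∫ y : E, logPow (p - (finrank ℝ E : ℝ) / 2) A B ((‖y‖ ^ 2 : ℝ)) *
        (fun v : E → ℂ => Δ v)^[p] φ y = φ 0 := by
  -- The extra invariant, no logarithm at negative exponents, is what makes the inductive step
  -- solvable when the exponent reaches 0.
  suffices H : ∀ q : ℕ, ∃ A B : ℝ, ((q : ℝ) + 1 - (finrank ℝ E : ℝ) / 2 < 0 → B = 0) ∧
      ∀ φ : E → ℂ, ContDiff ℝ ∞ φ → HasCompactSupport φ →
        ∫ y : E, logPow ((q : ℝ) + 1 - (finrank ℝ E : ℝ) / 2) A B ((‖y‖ ^ 2 : ℝ)) *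
          (fun v : E → ℂ => Δ v)^[q + 1] φ y = φ 0 by
    obtain ⟨q, rfl⟩ := Nat.exists_eq_add_of_le' hp
    obtain ⟨A, B, -, h⟩ := H q
    exact ⟨A, B, fun φ h1 h2 => by simpa using h φ h1 h2⟩
  intro q
  induction q with
  | zero =>
    have hc := integral_japaneseBracket_pos (E := E)
    set I := ∫ x : E, ((1 : ℝ) + ‖x‖ ^ 2) ^ (-((finrank ℝ E : ℝ) + 2) / 2) with hI
    have hn : (0 : ℝ) < finrank ℝ E := by exact_mod_cast finrank_pos
    obtain ⟨A, B, hA, hB, hneg⟩ : ∃ A B : ℝ, (1 - (finrank ℝ E : ℝ) / 2) * A + B = 1 ∧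
        (1 - (finrank ℝ E : ℝ) / 2) * B = 0 ∧ (1 - (finrank ℝ E : ℝ) / 2 < 0 → B = 0) := by
      -- In dimension two the profile is `log w`; otherwise it is a pure power.
      by_cases h0 : 1 - (finrank ℝ E : ℝ) / 2 = 0
      · exact ⟨0, 1, by simp, by simp [h0], fun h => absurd h0 h.ne⟩
      · exact ⟨(1 - (finrank ℝ E : ℝ) / 2)⁻¹, 0, by simp [h0], by simp, fun _ => rfl⟩
    have hc0 : (2 * finrank ℝ E * I) ≠ 0 := by positivity
    refine ⟨(2 * finrank ℝ E * I)⁻¹ * A, (2 * finrank ℝ E * I)⁻¹ * B,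
      fun h => by rw [hneg (by simpa using h), mul_zero], fun φ h1 h2 => ?_⟩
    have h3 := integral_logPow_mul_laplacian_of_deriv h1 h2 rfl hA hB
    rw [← hI] at h3
    have hz : ((0 : ℕ) : ℝ) + 1 - (finrank ℝ E : ℝ) / 2 = 1 - (finrank ℝ E : ℝ) / 2 := by simp
    have h4 : ∀ y : E, logPow (((0 : ℕ) : ℝ) + 1 - (finrank ℝ E : ℝ) / 2)
        ((2 * finrank ℝ E * I)⁻¹ * A) ((2 * finrank ℝ E * I)⁻¹ * B) ((‖y‖ ^ 2 : ℝ)) *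
          (fun v : E → ℂ => Δ v)^[0 + 1] φ y = ((2 * finrank ℝ E * I : ℝ) : ℂ)⁻¹ *
        (logPow (1 - (finrank ℝ E : ℝ) / 2) A B ((‖y‖ ^ 2 : ℝ)) * Δ φ y) := by
      intro y
      rw [hz, zero_add, Function.iterate_one]
      simp only [logPow, Complex.ofReal_mul, Complex.ofReal_inv]
      ring
    simp only [h4]
    rw [integral_const_mul, h3, inv_mul_cancel_left₀ (by exact_mod_cast hc0)]
  | succ q ih =>
    obtain ⟨A', B', hneg, h⟩ := ih
    set a : ℝ := ((q + 1 : ℕ) : ℝ) + 1 - (finrank ℝ E : ℝ) / 2 with ha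
    have ha1 : a - 1 = (q : ℝ) + 1 - (finrank ℝ E : ℝ) / 2 := by rw [ha]; push_cast; ring
    rw [← ha1] at hneg h
    have hm : (finrank ℝ E : ℝ) = 2 * (q + 1) - 2 * (a - 1) := by rw [ha1]; ring
    have hq : (0 : ℝ) < (q : ℝ) + 1 := by positivity
    obtain ⟨A, B, hA, hB, hneg'⟩ : ∃ A B : ℝ,
        4 * ((a - 1) * (a * A + B) + a * B) + 2 * finrank ℝ E * (a * A + B) = A' ∧
        4 * ((a - 1) * (a * B)) + 2 * finrank ℝ E * (a * B) = B' ∧ (a < 0 → B = 0) := by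
      rw [hm]
      -- After substituting for n the system reads `4(q+1)aB = B'` and `4(q+1)(aA + B) + 4aB = A'`.
      -- It is triangular for a ≠ 0. For a = 0 it forces B' = 0, which the invariant gives at
      -- exponent -1.
      by_cases h0 : a = 0
      · refine ⟨0, A' / (4 * (q + 1)), ?_, ?_, fun h => absurd h0 h.ne⟩
        · rw [h0]; field_simp; ring
        · rw [hneg (by linarith), h0]; ring
      · refine ⟨(A' - 4 * a * (B' / (4 * (q + 1) * a)) - B' / a) / (4 * (q + 1) * a),
          B' / (4 * (q + 1) * a), ?_, ?_, fun h => by rw [hneg (by linarith), zero_div]⟩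
        · field_simp; ring
        · field_simp; ring
    refine ⟨A, B, hneg', fun φ h1 h2 => ?_⟩
    rw [Function.iterate_succ_apply', integral_logPow_mul_laplacian (h1.iterate_laplacian _)
      (h2.iterate_laplacian _) A B (by rw [ha]; push_cast; linarith), hA, hB]
    exact h φ h1 h2

end FundamentalSolutionExists

/-! ### Holomorphic dependence of integrals on a parameter in `ℂⁿ` -/

section AnalyticComposition

open Filter Topology
open scoped ContDiff

/-- The Taylor coefficients of `G` along a continuous function, as continuous functions. -/
noncomputable def taylorCoeffAlong {K : Type*} [TopologicalSpace K] {G : ℂ → ℂ} {S : Set ℂ}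
    (hG : AnalyticOnNhd ℂ G S) (f : C(K, ℂ)) (hf : ∀ k, f k ∈ S) (m : ℕ) : C(K, ℂ) where
  toFun k := (m.factorial : ℂ)⁻¹ * iteratedDeriv m G (f k)
  continuous_toFun := by
    have h : ContinuousOn (iteratedDeriv m G) S := by
      rw [iteratedDeriv_eq_iterate]
      exact (hG.iterated_deriv m).continuousOn
    exact continuous_const.mul (h.comp_continuous f.continuous hf)

/-- Composition with a holomorphic function is an analytic operation on `C(K, ℂ)`. -/
theorem exists_analyticAt_comp_continuousMap {K : Type*} [TopologicalSpace K] [CompactSpace K]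
    {G : ℂ → ℂ} {S : Set ℂ} (hS : IsOpen S) (hG : AnalyticOnNhd ℂ G S) (f : C(K, ℂ))
    (hf : ∀ k, f k ∈ S) :
    ∃ Ψ : C(K, ℂ) → C(K, ℂ), AnalyticAt ℂ Ψ f ∧
      ∀ᶠ h in 𝓝 f, ∀ k, h k ∈ S ∧ Ψ h k = G (h k) := by
  have hcpt : IsCompact (Set.range f) := isCompact_range f.continuous
  obtain ⟨r, hr, hrS⟩ := hcpt.exists_cthickening_subset_open hS (Set.range_subset_iff.2 hf)
  obtain ⟨M, hM⟩ := (hcpt.cthickening (r := r)).exists_bound_of_continuousOn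
    (hG.continuousOn.mono hrS)
  have hball : ∀ k, Metric.closedBall (f k) r ⊆ Metric.cthickening r (Set.range f) := fun k =>
    Metric.closedBall_subset_cthickening (Set.mem_range_self k) r
  have hdiff : ∀ k, DifferentiableOn ℂ G (Metric.closedBall (f k) r) := fun k =>
    hG.differentiableOn.mono ((hball k).trans hrS)
  let c := taylorCoeffAlong hG f hf
  -- Cauchy's estimates on discs of a common radius r, available because f has compact range.
  have hc : ∀ m, ‖c m‖ * r ^ m ≤ |M| := by
    intro m
    rw [← le_div_iff₀ (by positivity), ContinuousMap.norm_le _ (by positivity)]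
    intro k
    have h1 := Complex.norm_iteratedDeriv_le_of_forall_mem_sphere_norm_le m hr
      (DifferentiableOn.diffContOnCl ((hdiff k).mono Metric.closure_ball_subset_closedBall))
      (C := |M|) fun z hz =>
        (hM z (hball k (Metric.sphere_subset_closedBall hz))).trans (le_abs_self M)
    have h2 : (0 : ℝ) < m.factorial := by positivity
    calc ‖c m k‖ = (m.factorial : ℝ)⁻¹ * ‖iteratedDeriv m G (f k)‖ := by
          simp [c, taylorCoeffAlong]
      _ ≤ (m.factorial : ℝ)⁻¹ * (m.factorial * |M| / r ^ m) := by gcongr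
      _ = |M| / r ^ m := by field_simp
  -- The Taylor expansions of G at all centres `f k` at once, as a single power series in the Banach
  -- algebra `C(K, ℂ)`.
  let P : FormalMultilinearSeries ℂ C(K, ℂ) C(K, ℂ) := fun m =>
    (ContinuousLinearMap.mul ℂ C(K, ℂ) (c m)).compContinuousMultilinearMap
      (ContinuousMultilinearMap.mkPiAlgebraFin ℂ m C(K, ℂ))
  have hP : ∀ m (h : C(K, ℂ)), P m (fun _ => h) = c m * h ^ m := by
    intro m h
    simp [P, ContinuousMultilinearMap.mkPiAlgebraFin_apply]
  have hrad : ENNReal.ofReal r ≤ P.radius := by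
    refine P.le_radius_of_bound (|M| * max 1 ‖(1 : C(K, ℂ))‖) fun m => ?_
    rw [Real.coe_toNNReal _ hr.le]
    have h1 : ‖P m‖ ≤ ‖c m‖ * max 1 ‖(1 : C(K, ℂ))‖ := by
      refine (ContinuousLinearMap.norm_compContinuousMultilinearMap_le _ _).trans ?_
      gcongr
      · exact ContinuousLinearMap.opNorm_mul_apply_le ℂ _ _
      · exact ContinuousMultilinearMap.norm_mkPiAlgebraFin_le
    calc ‖P m‖ * r ^ m ≤ ‖c m‖ * max 1 ‖(1 : C(K, ℂ))‖ * r ^ m := by gcongr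
      _ = ‖c m‖ * r ^ m * max 1 ‖(1 : C(K, ℂ))‖ := by ring
      _ ≤ _ := by gcongr; exact hc m
  have hrad0 : 0 < P.radius := (ENNReal.ofReal_pos.2 hr).trans_le hrad
  refine ⟨fun h => P.sum (h - f), ?_, ?_⟩
  · have h1 : AnalyticAt ℂ P.sum (f - f) := by
      rw [sub_self]
      exact (P.hasFPowerSeriesOnBall hrad0).analyticAt
    exact AnalyticAt.fun_comp (f := fun h => h - f) h1 (analyticAt_id.sub analyticAt_const)
  · filter_upwards [Metric.ball_mem_nhds f hr] with h hh k
    have hhk : h k ∈ Metric.ball (f k) r := by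
      rw [Metric.mem_ball] at hh ⊢
      exact (ContinuousMap.dist_apply_le_dist k).trans_lt hh
    refine ⟨hrS (hball k (Metric.ball_subset_closedBall hhk)), ?_⟩
    have hmem : h - f ∈ Metric.eball (0 : C(K, ℂ)) P.radius := by
      refine Metric.eball_subset_eball hrad ?_
      rw [Metric.eball_ofReal]
      simpa [dist_eq_norm] using hh
    have h1 := (P.hasSum hmem).mapL (ContinuousMap.evalCLM ℂ k)
    have h2 := Complex.hasSum_taylorSeries_on_ball
      ((hdiff k).mono Metric.ball_subset_closedBall) hhk
    refine h1.unique (h2.congr_fun ?_)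
    intro m
    simp [hP, c, taylorCoeffAlong]
    ring

/-- The complexified squared distance `∑ (z_i - y_i)²`. -/
noncomputable def sqDist {n : ℕ} (z : EuclideanSpace ℂ (Fin n)) (y : EuclideanSpace ℝ (Fin n)) :
    ℂ :=
  ∑ i, (z i - (y i : ℂ)) ^ 2

/-- The integral factors through `C(K, ℂ)`: a polynomial map `z ↦ sqDist z ·`, then composition with
G, which is analytic there, then the bounded functional of integration against g. -/
theorem analyticAt_integral_comp_sqDist {n : ℕ} {G : ℂ → ℂ} {S : Set ℂ} (hS : IsOpen S)
    (hG : AnalyticOnNhd ℂ G S) {K : Set (EuclideanSpace ℝ (Fin n))} (hK : IsCompact K)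
    {g : EuclideanSpace ℝ (Fin n) → ℂ} (hg : Continuous g) (hgK : ∀ y ∉ K, g y = 0)
    {z : EuclideanSpace ℂ (Fin n)} (hz : ∀ y ∈ K, sqDist z y ∈ S) :
    AnalyticAt ℂ (fun z => ∫ y, G (sqDist z y) * g y) z := by
  have : CompactSpace K := isCompact_iff_compactSpace.1 hK
  let Y : Fin n → C(K, ℂ) := fun i => ⟨fun y => ((y : EuclideanSpace ℝ (Fin n)) i : ℂ), by fun_prop⟩
  let q : EuclideanSpace ℂ (Fin n) → C(K, ℂ) := fun z => ∑ i, (z i • (1 : C(K, ℂ)) - Y i) ^ 2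
  have hqv : ∀ z (y : K), q z y = sqDist z y := by
    intro z y
    simp [q, sqDist, Y, ContinuousMap.sum_apply]
  have hq : AnalyticAt ℂ q z := by
    refine Finset.analyticAt_fun_sum _ fun i _ => AnalyticAt.pow (AnalyticAt.sub ?_
      analyticAt_const) 2
    exact ((EuclideanSpace.proj (𝕜 := ℂ) i).smulRight (1 : C(K, ℂ))).analyticAt z
  obtain ⟨Ψ, hΨ, hΨe⟩ := exists_analyticAt_comp_continuousMap hS hG (q z) fun y => by
    rw [hqv]; exact hz y y.2
  have hgi : IntegrableOn g K := hg.continuousOn.integrableOn_compact hK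
  have hmul : ∀ φ : C(K, ℂ), Integrable (fun y : K => φ y * g y)
      (Measure.comap Subtype.val volume) := by
    intro φ
    have h1 : Integrable (fun y : K => g y) (Measure.comap Subtype.val volume) :=
      (integrableOn_iff_comap_subtypeVal hK.measurableSet).1 hgi
    exact h1.bdd_mul φ.continuous.aestronglyMeasurable
      (Eventually.of_forall fun y => φ.norm_coe_le_norm y)
  let L : C(K, ℂ) →L[ℂ] ℂ := LinearMap.mkContinuous
    { toFun := fun φ => ∫ y : K, φ y * g y ∂(Measure.comap Subtype.val volume)
      map_add' := fun φ ψ => by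
        simp only [ContinuousMap.add_apply, add_mul]
        exact integral_add (hmul φ) (hmul ψ)
      map_smul' := fun c φ => by
        simp only [ContinuousMap.smul_apply, smul_eq_mul, mul_assoc, RingHom.id_apply]
        exact integral_const_mul _ _ }
    (∫ y : K, ‖g y‖ ∂(Measure.comap Subtype.val volume)) fun φ => by
      simp only [LinearMap.coe_mk, AddHom.coe_mk]
      rw [mul_comm, ← integral_const_mul]
      refine norm_integral_le_of_norm_le ?_ (Eventually.of_forall fun y => ?_)
      · have := (hmul 1).norm
        simp only [ContinuousMap.one_apply, one_mul] at this
        exact this.const_mul _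
      · rw [norm_mul]
        gcongr
        exact φ.norm_coe_le_norm y
  have hL : AnalyticAt ℂ (fun z => L (Ψ (q z))) z :=
    (L.analyticAt _).fun_comp (hΨ.fun_comp hq)
  refine hL.congr ?_
  filter_upwards [hq.continuousAt.eventually hΨe] with w hw
  have h1 : L (Ψ (q w)) = ∫ y : K, G (sqDist w y) * g y ∂(Measure.comap Subtype.val volume) := by
    refine integral_congr_ae (Eventually.of_forall fun y => ?_)
    simp only [(hw y).2, hqv]
  rw [h1, integral_subtype_comap hK.measurableSet fun y => G (sqDist w y) * g y]
  refine setIntegral_eq_integral_of_forall_compl_eq_zero fun y hy => ?_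
  rw [hgK y hy, mul_zero]

end AnalyticComposition

/-! ### Rotations of the ball, the domain of extension, and identity theorems -/

section Rotations

open Filter Topology

theorem eqOn_zero_of_eventually_ofReal {h : ℂ → ℂ} {U : Set ℂ} (hh : AnalyticOnNhd ℂ h U)
    (hU : IsPreconnected U) (h0 : (0 : ℂ) ∈ U) (hr : ∀ᶠ t : ℝ in 𝓝 0, h t = 0) :
    Set.EqOn h 0 U := by
  refine hh.eqOn_zero_of_preconnected_of_frequently_eq_zero hU h0 ?_
  have h1 : Tendsto (fun t : ℝ => (t : ℂ)) (𝓝[≠] 0) (𝓝[≠] 0) := by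
    refine tendsto_nhdsWithin_iff.2 ⟨?_, ?_⟩
    · simpa using (Complex.continuous_ofReal.tendsto 0).mono_left nhdsWithin_le_nhds
    · filter_upwards [self_mem_nhdsWithin] with t ht
      simpa using ht
  exact h1.frequently (hr.filter_mono nhdsWithin_le_nhds).frequently

variable {n : ℕ}

theorem rotVec_apply (φ : ℝ) (x : EuclideanSpace ℝ (Fin n)) (i : Fin n) :
    rotVec φ x i = Complex.exp (φ * Complex.I) * x i := by
  simp [rotVec]

theorem rotVec_zero_apply (x : EuclideanSpace ℝ (Fin n)) (i : Fin n) :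
    rotVec 0 x i = x i := by
  simp [rotVec]

theorem norm_rotVec (φ : ℝ) (x : EuclideanSpace ℝ (Fin n)) : ‖rotVec φ x‖ = ‖x‖ := by
  simp [EuclideanSpace.norm_eq, rotVec_apply]

/-- The embedding `x ↦ e^{iφ} x` of `ℝⁿ` into `ℂⁿ`, as a real linear isometry. -/
noncomputable def rotVecₗᵢ (n : ℕ) (φ : ℝ) :
    EuclideanSpace ℝ (Fin n) →ₗᵢ[ℝ] EuclideanSpace ℂ (Fin n) where
  toFun := rotVec φ
  map_add' x y := by ext i; simp [rotVec_apply, mul_add]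
  map_smul' c x := by ext i; simp [rotVec_apply]; ring
  norm_map' := norm_rotVec φ

theorem continuous_rotVec (φ : ℝ) : Continuous (rotVec φ : EuclideanSpace ℝ (Fin n) → _) :=
  (rotVecₗᵢ n φ).continuous

theorem rotVec_mem_allRotations (ψ : ℝ) {x : EuclideanSpace ℝ (Fin n)} (hx : x ∈ unitBall n) :
    rotVec ψ x ∈ allRotations n := ⟨ψ, x, hx, rfl⟩

/-- Polar form of c: points of the complex line through a real x are rotations of real multiples of
x. -/
theorem smul_rotVec_zero (c : ℂ) (x : EuclideanSpace ℝ (Fin n)) :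
    c • rotVec 0 x = rotVec c.arg (‖c‖ • x) := by
  ext i
  rw [rotVec_apply, PiLp.smul_apply, rotVec_zero_apply, PiLp.smul_apply, smul_eq_mul,
    smul_eq_mul, Complex.ofReal_mul, ← mul_assoc, mul_comm (Complex.exp _),
    Complex.norm_mul_exp_arg_mul_I]

/-- Two functions that are holomorphic near the rotations `e^{iψ} t x`, `|t| ≤ 1`, and agree at the
real points among them agree at all of them. -/
theorem eq_rotVec_of_eq_real {F F' : EuclideanSpace ℂ (Fin n) → ℂ} {x : EuclideanSpace ℝ (Fin n)}
    (hF : ∀ ψ t : ℝ, |t| ≤ 1 → AnalyticAt ℂ F (rotVec ψ (t • x)))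
    (hF' : ∀ ψ t : ℝ, |t| ≤ 1 → AnalyticAt ℂ F' (rotVec ψ (t • x)))
    (h : ∀ t : ℝ, |t| ≤ 1 → F (rotVec 0 (t • x)) = F' (rotVec 0 (t • x))) (ψ : ℝ) :
    F (rotVec ψ x) = F' (rotVec ψ x) := by
  have hline : ∀ c : ℂ, AnalyticAt ℂ (fun c : ℂ => c • rotVec 0 x) c :=
    fun c => ((ContinuousLinearMap.id ℂ ℂ).smulRight (rotVec 0 x)).analyticAt c
  -- The disc is closed because the target point `e^{iψ}` lies on its boundary.
  have h1 := eqOn_zero_of_eventually_ofReal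
    (h := fun c => F (c • rotVec 0 x) - F' (c • rotVec 0 x)) (U := Metric.closedBall 0 1)
    (fun c hc => by
      have hc' : |‖c‖| ≤ 1 := by simpa using hc
      refine (AnalyticAt.fun_comp ?_ (hline c)).sub (AnalyticAt.fun_comp ?_ (hline c))
      · rw [smul_rotVec_zero]; exact hF _ _ hc'
      · rw [smul_rotVec_zero]; exact hF' _ _ hc')
    (convex_closedBall (0 : ℂ) 1).isPreconnected (by simp) ?_
  · have h2 := h1 (x := Complex.exp (ψ * Complex.I)) (by simp)
    have h3 : Complex.exp (ψ * Complex.I) • rotVec 0 x = rotVec ψ x := by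
      ext i; simp [rotVec_apply]
    simpa [h3, sub_eq_zero] using h2
  · filter_upwards [Metric.closedBall_mem_nhds (0 : ℝ) one_pos] with t ht
    have h3 : ((t : ℝ) : ℂ) • rotVec 0 x = rotVec 0 (t • x) := by
      ext i; simp [rotVec_apply]
    rw [h3, h t (by simpa using ht), sub_self]

theorem smul_mem_unitBall {t : ℝ} (ht : |t| ≤ 1) {x : EuclideanSpace ℝ (Fin n)}
    (hx : x ∈ unitBall n) : t • x ∈ unitBall n := by
  rw [mem_ball_zero_iff] at hx ⊢
  rw [norm_smul]
  exact (mul_le_of_le_one_left (norm_nonneg _) ht).trans_lt hx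

/-- A function that is holomorphic near the rotations of the ball is determined there by its
values on the ball. -/
theorem AnalyticOnNhd.eqOn_allRotations {F F' : EuclideanSpace ℂ (Fin n) → ℂ}
    (hF : AnalyticOnNhd ℂ F (allRotations n)) (hF' : AnalyticOnNhd ℂ F' (allRotations n))
    (h : ∀ x ∈ unitBall n, F (rotVec 0 x) = F' (rotVec 0 x)) :
    Set.EqOn F F' (allRotations n) := by
  rintro _ ⟨ψ, x, hx, rfl⟩
  exact eq_rotVec_of_eq_real
    (fun ψ t ht => hF _ (rotVec_mem_allRotations ψ (smul_mem_unitBall ht hx)))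
    (fun ψ t ht => hF' _ (rotVec_mem_allRotations ψ (smul_mem_unitBall ht hx)))
    (fun t ht => h _ (smul_mem_unitBall ht hx)) ψ

theorem sqDist_rotVec_zero (x y : EuclideanSpace ℝ (Fin n)) :
    sqDist (rotVec 0 x) y = ((‖y - x‖ ^ 2 : ℝ) : ℂ) := by
  rw [norm_sub_rev, EuclideanSpace.norm_sq_eq]
  simp only [sqDist, rotVec_zero_apply, PiLp.sub_apply, Real.norm_eq_abs, sq_abs]
  push_cast
  rfl

/-- The polynomial `1 - 2 z·v + |v|² z·z`. -/
noncomputable def lieQuad (z : EuclideanSpace ℂ (Fin n)) (v : EuclideanSpace ℝ (Fin n)) : ℂ :=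
  1 - 2 * ∑ i, z i * v i + (‖v‖ ^ 2 : ℝ) * ∑ i, z i ^ 2

/-- Put `e^{iψ} = c + id`, `s = ⟨x, v⟩` and `b = |v||x|`, so `|s| ≤ b < 1` and the value is `1 -
2e^{iψ}s + e^{2iψ}b²`. Its imaginary part is `2d(cb² - s)`. If d = 0, the value is at least `(1 -
b)²`; if `s = cb²`, it equals `1 - b²`. So it is positive whenever it is real. -/
theorem lieQuad_rotVec_mem_slitPlane (ψ : ℝ) {x v : EuclideanSpace ℝ (Fin n)}
    (h : ‖v‖ * ‖x‖ < 1) : lieQuad (rotVec ψ x) v ∈ Complex.slitPlane := by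
  have hcs : |inner ℝ x v| ≤ ‖v‖ * ‖x‖ := by
    rw [mul_comm]; exact abs_real_inner_le_norm x v
  have hb : 0 ≤ ‖v‖ * ‖x‖ := by positivity
  have h1 : lieQuad (rotVec ψ x) v = 1 - 2 * Complex.exp (ψ * Complex.I) * ((inner ℝ x v : ℝ) : ℂ)
      + Complex.exp (ψ * Complex.I) ^ 2 * (((‖v‖ * ‖x‖) ^ 2 : ℝ) : ℂ) := by
    have h2 : (∑ i, rotVec ψ x i * (v i : ℂ)) =
        Complex.exp (ψ * Complex.I) * ((inner ℝ x v : ℝ) : ℂ) := by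
      simp only [rotVec_apply, PiLp.inner_apply, RCLike.inner_apply, conj_trivial,
        Complex.ofReal_sum, Finset.mul_sum, Complex.ofReal_mul]
      exact Finset.sum_congr rfl fun i _ => by ring
    have h3 : (∑ i, rotVec ψ x i ^ 2) = Complex.exp (ψ * Complex.I) ^ 2 * ((‖x‖ ^ 2 : ℝ) : ℂ) := by
      rw [EuclideanSpace.norm_sq_eq]
      simp only [rotVec_apply, Real.norm_eq_abs, sq_abs, Complex.ofReal_sum, Finset.mul_sum,
        Complex.ofReal_pow]
      exact Finset.sum_congr rfl fun i _ => by ring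
    rw [lieQuad, h2, h3]
    push_cast
    ring
  rw [h1]
  generalize inner ℝ x v = s at hcs
  generalize ‖v‖ * ‖x‖ = b at hcs h hb
  have hcd := Real.cos_sq_add_sin_sq ψ
  rw [Complex.exp_mul_I, ← Complex.ofReal_cos, ← Complex.ofReal_sin]
  generalize Real.cos ψ = c at hcd
  generalize Real.sin ψ = d at hcd
  rw [Complex.mem_slitPlane_iff_not_le_zero, Complex.le_def]
  rintro ⟨hre, him⟩
  simp [pow_two] at hre him
  obtain ⟨hs1, hs2⟩ := abs_le.1 hcs
  have him' : d * (c * b ^ 2 - s) = 0 := by nlinarith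
  rcases mul_eq_zero.1 him' with hd | hs
  · subst hd
    have : c * c = 1 := by nlinarith
    rcases mul_self_eq_one_iff.1 this with hc | hc <;> subst hc <;> nlinarith
  · have hs' : s = c * b ^ 2 := by linarith
    subst hs'
    nlinarith

/-- The inversion `v = y/|y|²` maps the exterior `|y| ≥ a` into the compact ball `|v| ≤ 1/a`, with v
= 0 standing for infinity. Compactness then makes `lieDomain` open. -/
theorem norm_sq_mul_lieQuad (z : EuclideanSpace ℂ (Fin n)) {y : EuclideanSpace ℝ (Fin n)}
    (hy : y ≠ 0) : ((‖y‖ ^ 2 : ℝ) : ℂ) * lieQuad z ((‖y‖ ^ 2)⁻¹ • y) = sqDist z y := by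
  have hy0 : ((‖y‖ : ℝ) : ℂ) ≠ 0 := by exact_mod_cast (norm_pos_iff.2 hy).ne'
  have h1 : sqDist z y = (∑ i, z i ^ 2) - 2 * (∑ i, z i * y i) + ((‖y‖ ^ 2 : ℝ) : ℂ) := by
    rw [EuclideanSpace.norm_sq_eq]
    simp only [sqDist, Real.norm_eq_abs, sq_abs, Complex.ofReal_sum, Finset.mul_sum,
      ← Finset.sum_sub_distrib, ← Finset.sum_add_distrib, Complex.ofReal_pow]
    exact Finset.sum_congr rfl fun i _ => by ring
  have h2 : ∑ i, z i * ((((‖y‖ ^ 2)⁻¹ • y : EuclideanSpace ℝ (Fin n)) i : ℝ) : ℂ) =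
      (((‖y‖ : ℝ) : ℂ) ^ 2)⁻¹ * ∑ i, z i * y i := by
    simp only [PiLp.smul_apply, smul_eq_mul, Finset.mul_sum]
    push_cast
    exact Finset.sum_congr rfl fun i _ => by ring
  have h3 : ‖(‖y‖ ^ 2)⁻¹ • y‖ ^ 2 = (‖y‖ ^ 2)⁻¹ := by
    rw [norm_smul, norm_inv, norm_pow, norm_norm]
    have := norm_pos_iff.2 hy
    field_simp
  rw [h1, lieQuad, h2, h3]
  push_cast
  field_simp
  ring

/-- An open star-shaped neighbourhood in `ℂⁿ` of the rotations of the ball of radius `a`, on which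
`(z - y)·(z - y)` avoids the negative real axis for all real `y` outside that ball. -/
def lieDomain (n : ℕ) (a : ℝ) : Set (EuclideanSpace ℂ (Fin n)) :=
  {z | ∀ v : EuclideanSpace ℝ (Fin n), ‖v‖ * a ≤ 1 → lieQuad z v ∈ Complex.slitPlane}

theorem lieDomain_mono {a b : ℝ} (h : a ≤ b) : lieDomain n a ⊆ lieDomain n b :=
  fun _ hz v hv => hz v ((mul_le_mul_of_nonneg_left h (norm_nonneg v)).trans hv)

theorem rotVec_mem_lieDomain {a : ℝ} (ψ : ℝ) {x : EuclideanSpace ℝ (Fin n)} (hx : ‖x‖ < a) :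
    rotVec ψ x ∈ lieDomain n a := by
  intro v hv
  refine lieQuad_rotVec_mem_slitPlane ψ ?_
  rcases (norm_nonneg v).eq_or_lt with h0 | h0
  · rw [← h0, zero_mul]; exact one_pos
  · exact (mul_lt_mul_of_pos_left hx h0).trans_le hv

theorem sqDist_mem_slitPlane {a : ℝ} (ha : 0 < a) {z : EuclideanSpace ℂ (Fin n)}
    (hz : z ∈ lieDomain n a) {y : EuclideanSpace ℝ (Fin n)} (hy : a ≤ ‖y‖) :
    sqDist z y ∈ Complex.slitPlane := by
  have hy0 : 0 < ‖y‖ := ha.trans_le hy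
  rw [← norm_sq_mul_lieQuad z (norm_pos_iff.1 hy0)]
  have h1 := hz ((‖y‖ ^ 2)⁻¹ • y) (by
    rw [norm_smul, norm_inv, norm_pow, norm_norm]
    field_simp
    exact hy)
  have hp : 0 < ‖y‖ ^ 2 := by positivity
  rw [Complex.mem_slitPlane_iff] at h1 ⊢
  rw [Complex.re_ofReal_mul, Complex.im_ofReal_mul]
  exact h1.imp (fun h => mul_pos hp h) fun h => mul_ne_zero hp.ne' h

theorem isOpen_lieDomain {a : ℝ} (ha : 0 < a) : IsOpen (lieDomain n a) := by
  rw [isOpen_iff_eventually]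
  intro z hz
  have hcont : Continuous fun q : EuclideanSpace ℂ (Fin n) × EuclideanSpace ℝ (Fin n) =>
      lieQuad q.1 q.2 := by
    unfold lieQuad
    fun_prop
  have h1 : ∀ᶠ w in 𝓝 z, ∀ v ∈ Metric.closedBall (0 : EuclideanSpace ℝ (Fin n)) (1 / a),
      lieQuad w v ∈ Complex.slitPlane := by
    refine (isCompact_closedBall _ _).eventually_forall_of_forall_eventually fun v hv => ?_
    refine hcont.continuousAt.eventually (Complex.isOpen_slitPlane.mem_nhds (hz v ?_))
    rwa [mem_closedBall_zero_iff, le_div_iff₀ ha] at hv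
  filter_upwards [h1] with w hw v hv
  exact hw v (by rwa [mem_closedBall_zero_iff, le_div_iff₀ ha])

theorem zero_mem_lieDomain (a : ℝ) : (0 : EuclideanSpace ℂ (Fin n)) ∈ lieDomain n a :=
  fun v _ => by simp [lieQuad]

/-- A real factor t can be moved from z to v, and shrinking v preserves the constraint, so the
domain is star-shaped about 0. -/
theorem isPreconnected_lieDomain (a : ℝ) : IsPreconnected (lieDomain n a) := by
  refine (StarConvex.isPathConnected (a := 0) ?_ (zero_mem_lieDomain a)).isConnected.isPreconnected
  rw [starConvex_zero_iff]
  intro z hz t ht0 ht1 v hv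
  have h1 : lieQuad (t • z) v = lieQuad z (t • v) := by
    have h2 : ‖t • v‖ ^ 2 = t ^ 2 * ‖v‖ ^ 2 := by
      rw [norm_smul, mul_pow, Real.norm_eq_abs, sq_abs]
    rw [lieQuad, lieQuad, h2]
    simp only [PiLp.smul_apply, Complex.real_smul, Finset.mul_sum, smul_eq_mul]
    push_cast
    congr 2
    · exact congrArg _ (funext fun i => by ring)
    · exact funext fun i => by ring
  rw [h1]
  refine hz _ ?_
  rw [norm_smul, Real.norm_of_nonneg ht0]
  by_cases ha : 0 ≤ a
  · calc t * ‖v‖ * a = t * (‖v‖ * a) := by ring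
      _ ≤ 1 * (‖v‖ * a) := by gcongr
      _ ≤ 1 := by rwa [one_mul]
  · have : t * ‖v‖ * a ≤ 0 := mul_nonpos_of_nonneg_of_nonpos (by positivity) (not_le.1 ha).le
    linarith

/-- A holomorphic function on `lieDomain n a` is determined by its values on the real ball. -/
theorem AnalyticOnNhd.eqOn_lieDomain {a : ℝ} (ha : 0 < a) {F F' : EuclideanSpace ℂ (Fin n) → ℂ}
    (hF : AnalyticOnNhd ℂ F (lieDomain n a)) (hF' : AnalyticOnNhd ℂ F' (lieDomain n a))
    (h : ∀ x : EuclideanSpace ℝ (Fin n), ‖x‖ < a → F (rotVec 0 x) = F' (rotVec 0 x)) :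
    Set.EqOn F F' (lieDomain n a) := by
  have h0 := zero_mem_lieDomain (n := n) a
  refine hF.eqOn_of_preconnected_of_eventuallyEq hF' (isPreconnected_lieDomain a) h0 ?_
  obtain ⟨ρ, hρ, hρs⟩ := Metric.isOpen_iff.1 (isOpen_lieDomain ha) 0 h0
  filter_upwards [Metric.ball_mem_nhds (0 : EuclideanSpace ℂ (Fin n)) (lt_min hρ ha)] with z hz
  let x : EuclideanSpace ℝ (Fin n) := WithLp.toLp 2 fun i => (z i).re
  let y : EuclideanSpace ℝ (Fin n) := WithLp.toLp 2 fun i => (z i).im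
  have hx : ‖x‖ ≤ ‖z‖ := by
    rw [EuclideanSpace.norm_eq, EuclideanSpace.norm_eq]
    gcongr with i
    exact Complex.abs_re_le_norm (z i)
  rw [mem_ball_zero_iff, lt_min_iff] at hz
  -- For `z = x + iy`, the complex line `c ↦ x + cy` passes through real points for small real c and
  -- through z at c = i; the set of c mapped into a ball about 0 is convex.
  let ℓ : ℂ → EuclideanSpace ℂ (Fin n) := fun c => rotVec 0 x + c • rotVec 0 y
  have hℓ : ∀ c, AnalyticAt ℂ ℓ c := fun c =>
    analyticAt_const.add (((ContinuousLinearMap.id ℂ ℂ).smulRight (rotVec 0 y)).analyticAt c)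
  have hℓr : ∀ t : ℝ, ℓ t = rotVec 0 (x + t • y) := by
    intro t; ext i; simp [ℓ, rotVec_apply]
  have hconv : Convex ℝ (ℓ ⁻¹' Metric.ball 0 ρ) := by
    intro c hc d hd s t hs ht hst
    have h2 : ℓ (s • c + t • d) = s • ℓ c + t • ℓ d := by
      have h3 : (rotVec 0 x : EuclideanSpace ℂ (Fin n)) = s • rotVec 0 x + t • rotVec 0 x := by
        rw [← add_smul, hst, one_smul]
      simp only [ℓ, add_smul, smul_add, smul_assoc]
      nth_rw 1 [h3]
      abel
    rw [Set.mem_preimage, h2]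
    exact convex_ball (0 : EuclideanSpace ℂ (Fin n)) ρ hc hd hs ht hst
  have h00 : ℓ 0 = rotVec 0 x := by simp [ℓ]
  have h1 := eqOn_zero_of_eventually_ofReal
    (h := fun c => F (ℓ c) - F' (ℓ c)) (U := ℓ ⁻¹' Metric.ball 0 ρ)
    (fun c hc => ((hF _ (hρs hc)).fun_comp (hℓ c)).sub ((hF' _ (hρs hc)).fun_comp (hℓ c)))
    hconv.isPreconnected ?_ ?_
  · have hI : ℓ Complex.I = z := by
      ext i
      simp only [ℓ, PiLp.add_apply, PiLp.smul_apply, rotVec_zero_apply, smul_eq_mul, x, y]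
      rw [mul_comm]
      exact Complex.re_add_im (z i)
    have h2 := h1 (x := Complex.I) (by
      rw [Set.mem_preimage, hI, mem_ball_zero_iff]; exact hz.1)
    simpa [hI, sub_eq_zero] using h2
  · rw [Set.mem_preimage, h00, mem_ball_zero_iff, norm_rotVec]
    exact hx.trans_lt hz.1
  · have hc : ContinuousAt (fun t : ℝ => ‖x + t • y‖) 0 := by fun_prop
    have hlt : ‖x + (0 : ℝ) • y‖ < a := by
      rw [zero_smul, add_zero]
      exact hx.trans_lt hz.2
    filter_upwards [hc.eventually (gt_mem_nhds hlt)] with t ht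
    rw [hℓr, h _ ht, sub_self]

end Rotations

/-! ### Holomorphic extension and the evaluation kernel -/

section Representation

open Laplacian Filter Topology Module
open scoped ContDiff

/-- A derivative in y alone is the joint derivative in the direction (0, v), so joint smoothness in
(z, y) survives. -/
theorem ContDiffOn.partial_fderiv {P V : Type*} [NormedAddCommGroup P] [NormedSpace ℝ P]
    [NormedAddCommGroup V] [NormedSpace ℝ V] {h : P → V → ℂ} {s : Set P} (hs : IsOpen s)
    (hh : ContDiffOn ℝ ∞ (Function.uncurry h) (s ×ˢ Set.univ)) (v : V) :
    ContDiffOn ℝ ∞ (Function.uncurry fun z y => fderiv ℝ (h z) y v) (s ×ˢ Set.univ) := by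
  have ho : IsOpen (s ×ˢ (Set.univ : Set V)) := hs.prod isOpen_univ
  have h1 : ContDiffOn ℝ ∞ (fun q => fderiv ℝ (Function.uncurry h) q ((0 : P), v))
      (s ×ˢ Set.univ) :=
    (hh.fderiv_of_isOpen ho (by norm_cast)).clm_apply contDiffOn_const
  refine h1.congr ?_
  rintro ⟨z, y⟩ hq
  have h2 : HasFDerivAt (Function.uncurry h) (fderiv ℝ (Function.uncurry h) (z, y)) (z, y) :=
    ((hh.contDiffAt (ho.mem_nhds hq)).differentiableAt (by norm_num)).hasFDerivAt
  have h3 : HasFDerivAt (h z) ((fderiv ℝ (Function.uncurry h) (z, y)).comp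
      (ContinuousLinearMap.inr ℝ P V)) y := h2.comp y (hasFDerivAt_prodMk_right z y)
  simp [Function.uncurry, h3.fderiv]

theorem ContDiffOn.partial_iterate_laplacian {P V : Type*} [NormedAddCommGroup P]
    [NormedSpace ℝ P] [NormedAddCommGroup V] [InnerProductSpace ℝ V] [FiniteDimensional ℝ V]
    {h : P → V → ℂ} {s : Set P} (hs : IsOpen s)
    (hh : ContDiffOn ℝ ∞ (Function.uncurry h) (s ×ˢ Set.univ)) (p : ℕ) :
    ContDiffOn ℝ ∞ (Function.uncurry fun z y => (fun v : V → ℂ => Δ v)^[p] (h z) y)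
      (s ×ˢ Set.univ) := by
  induction p with
  | zero => exact hh
  | succ p ih =>
    have h1 : ContDiffOn ℝ ∞ (fun q : P × V => ∑ i, Function.uncurry (fun z y =>
        fderiv ℝ (fun y => fderiv ℝ ((fun v : V → ℂ => Δ v)^[p] (h z)) y
          (stdOrthonormalBasis ℝ V i)) y (stdOrthonormalBasis ℝ V i)) q) (s ×ˢ Set.univ) :=
      ContDiffOn.sum fun i _ => (ih.partial_fderiv hs _).partial_fderiv hs _
    refine h1.congr ?_
    rintro ⟨z, y⟩ hq
    have h2 : ContDiff ℝ ∞ ((fun v : V → ℂ => Δ v)^[p] (h z)) :=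
      ih.comp_contDiff (contDiff_prodMk_right z) fun y => ⟨hq.1, Set.mem_univ _⟩
    simp only [Function.uncurry, Function.iterate_succ_apply']
    exact laplacian_eq_sum_fderiv _ (h2.contDiffAt.of_le (by norm_cast))

theorem contDiff_mul_of_tsupport_subset {V : Type*} [NormedAddCommGroup V] [NormedSpace ℝ V]
    {χ u : V → ℂ} {s : Set V} (hs : IsOpen s) (hχ : ContDiff ℝ ∞ χ) (hu : ContDiffOn ℝ ∞ u s)
    (h : tsupport χ ⊆ s) : ContDiff ℝ ∞ fun y => χ y * u y := by
  rw [contDiff_iff_contDiffAt]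
  intro y
  by_cases hy : y ∈ s
  · exact hχ.contDiffAt.mul (hu.contDiffAt (hs.mem_nhds hy))
  · have h0 := notMem_tsupport_iff_eventuallyEq.1 fun h' => hy (h h')
    refine (contDiffAt_const (c := (0 : ℂ))).congr_of_eventuallyEq ?_
    filter_upwards [h0] with y hy
    simp [hy]

theorem exists_contDiff_cutoff {V : Type*} [NormedAddCommGroup V] [InnerProductSpace ℝ V]
    [FiniteDimensional ℝ V] {r R : ℝ} (hr : 0 < r) (hR : r < R) :
    ∃ χ : V → ℂ, ContDiff ℝ ∞ χ ∧ tsupport χ ⊆ Metric.closedBall 0 R ∧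
      (∀ y, ‖y‖ ≤ r → χ y = 1) ∧ ∀ y, R ≤ ‖y‖ → χ y = 0 := by
  let f : ContDiffBump (0 : V) := ⟨r, R, hr, hR⟩
  refine ⟨fun y => (f y : ℂ), Complex.ofRealCLM.contDiff.comp f.contDiff, ?_, ?_, ?_⟩
  · refine (closure_mono ?_).trans f.tsupport_eq.subset
    intro y hy
    simpa using hy
  · intro y hy
    simp [f.one_of_mem_closedBall (x := y) (by simpa using hy)]
  · intro y hy
    simp [f.zero_of_le_dist (x := y) (by simpa using hy)]

/-- Smooth solutions of `Δ ^ p u = 0` on `s`. -/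
def IsSmoothPolyharmonicOn {V : Type*} [NormedAddCommGroup V] [InnerProductSpace ℝ V]
    [FiniteDimensional ℝ V] (p : ℕ) (u : V → ℂ) (s : Set V) : Prop :=
  ContDiffOn ℝ ∞ u s ∧ ∀ x ∈ s, (fun v : V → ℂ => Δ v)^[p] u x = 0

/-- `y ↦ G (|y|²)` is a fundamental solution of `Δ ^ p` on `ℝⁿ`, with `G` holomorphic. -/
def IsRadialFundamentalSolution (n p : ℕ) (G : ℂ → ℂ) : Prop :=
  AnalyticOnNhd ℂ G Complex.slitPlane ∧
    ∀ φ : EuclideanSpace ℝ (Fin n) → ℂ, ContDiff ℝ ∞ φ → HasCompactSupport φ →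
      ∫ y, G ((‖y‖ ^ 2 : ℝ)) * (fun v : EuclideanSpace ℝ (Fin n) → ℂ => Δ v)^[p] φ y = φ 0

theorem exists_isRadialFundamentalSolution {n p : ℕ} (hn : 1 ≤ n) (hp : 1 ≤ p) :
    ∃ G, IsRadialFundamentalSolution n p G := by
  have : NeZero n := ⟨by omega⟩
  obtain ⟨A, B, h⟩ := exists_fundamentalSolution (E := EuclideanSpace ℝ (Fin n)) p hp
  exact ⟨_, analyticOnNhd_logPow _ A B, h⟩

variable {n p : ℕ} {G : ℂ → ℂ}

theorem IsRadialFundamentalSolution.integral_eq (hG : IsRadialFundamentalSolution n p G)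
    {φ : EuclideanSpace ℝ (Fin n) → ℂ} (hφ : ContDiff ℝ ∞ φ) (hc : HasCompactSupport φ)
    (x : EuclideanSpace ℝ (Fin n)) :
    ∫ y, G (sqDist (rotVec 0 x) y) *
      (fun v : EuclideanSpace ℝ (Fin n) → ℂ => Δ v)^[p] φ y = φ x := by
  have h1 := hG.2 (fun y => φ (x + y)) (hφ.comp (contDiff_const.add contDiff_id))
    (hc.comp_homeomorph (Homeomorph.addLeft x))
  rw [add_zero, iterate_laplacian_comp_const_add] at h1
  rw [← h1, ← integral_add_left_eq_self _ x]
  simp [sqDist_rotVec_zero]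

/-- A polyharmonic function cut off near the boundary of the ball, after application of `Δ ^ p`. -/
theorem exists_source {r R : ℝ} (hr : 0 < r) (hrR : r < R) (hR : R < 1) :
    ∃ χ : EuclideanSpace ℝ (Fin n) → ℂ, ContDiff ℝ ∞ χ ∧ (∀ y, R ≤ ‖y‖ → χ y = 0) ∧
      ∀ u, IsSmoothPolyharmonicOn p u (unitBall n) →
        ContDiff ℝ ∞ (fun y => χ y * u y) ∧ HasCompactSupport (fun y => χ y * u y) ∧
        (∀ y, ‖y‖ < r ∨ R < ‖y‖ →
          (fun v : EuclideanSpace ℝ (Fin n) → ℂ => Δ v)^[p] (fun y => χ y * u y) y = 0) ∧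
        ∀ y, ‖y‖ ≤ r → χ y * u y = u y := by
  obtain ⟨χ, h1, h2, h3, h4⟩ := exists_contDiff_cutoff (V := EuclideanSpace ℝ (Fin n)) hr hrR
  refine ⟨χ, h1, h4, fun u hu => ⟨contDiff_mul_of_tsupport_subset Metric.isOpen_ball h1 hu.1
    (h2.trans (Metric.closedBall_subset_ball hR)), ?_, ?_, fun y hy => by rw [h3 y hy, one_mul]⟩⟩
  · exact (HasCompactSupport.of_support_subset_isCompact (isCompact_closedBall 0 R)
      ((subset_tsupport _).trans h2)).mul_right
  · rintro y (hy | hy)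
    · have h5 : (fun y => χ y * u y) =ᶠ[𝓝 y] u := by
        filter_upwards [continuous_norm.continuousAt.eventually (gt_mem_nhds hy)] with w hw
        rw [h3 w (le_of_lt hw), one_mul]
      rw [(h5.iterate_laplacian p).eq_of_nhds]
      exact hu.2 y (by rw [mem_ball_zero_iff]; linarith)
    · have h5 : (fun y => χ y * u y) =ᶠ[𝓝 y] 0 := by
        filter_upwards [continuous_norm.continuousAt.eventually (lt_mem_nhds hy)] with w hw
        simp [h4 w (le_of_lt hw)]
      rw [(h5.iterate_laplacian p).eq_of_nhds, iterate_laplacian_zero]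
      rfl

/-- The closed annulus `r ≤ |y| ≤ R`. -/
abbrev annulus (n : ℕ) (r R : ℝ) : Set (EuclideanSpace ℝ (Fin n)) := {y | r ≤ ‖y‖ ∧ ‖y‖ ≤ R}

theorem lt_or_lt_of_notMem_annulus {r R : ℝ} {y : EuclideanSpace ℝ (Fin n)}
    (hy : y ∉ annulus n r R) : ‖y‖ < r ∨ R < ‖y‖ := by
  by_contra h
  push Not at h
  exact hy h

theorem isCompact_annulus (r R : ℝ) : IsCompact (annulus n r R) := by
  refine (isCompact_closedBall (0 : EuclideanSpace ℝ (Fin n)) R).of_isClosed_subset ?_ ?_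
  · exact (isClosed_le continuous_const continuous_norm).inter
      (isClosed_le continuous_norm continuous_const)
  · intro y hy
    simpa using hy.2

theorem IsRadialFundamentalSolution.analyticOnNhd_integral
    (hG : IsRadialFundamentalSolution n p G) {r R : ℝ} (hr : 0 < r)
    {g : EuclideanSpace ℝ (Fin n) → ℂ} (hg : Continuous g)
    (h0 : ∀ y, ‖y‖ < r ∨ R < ‖y‖ → g y = 0) :
    AnalyticOnNhd ℂ (fun z => ∫ y, G (sqDist z y) * g y) (lieDomain n r) := by
  intro z hz
  refine analyticAt_integral_comp_sqDist Complex.isOpen_slitPlane hG.1 (isCompact_annulus r R) hg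
    (fun y hy => h0 y (lt_or_lt_of_notMem_annulus hy)) fun y hy =>
      sqDist_mem_slitPlane hr hz hy.1

/-- Cut u off between the radii a and (a + 1)/2. The source `Δ^p(χu)` lives where `|y| ≥ a`, and
there the kernel is holomorphic in z throughout `lieDomain n a`. -/
theorem IsSmoothPolyharmonicOn.exists_analyticOnNhd_lieDomain
    (hG : IsRadialFundamentalSolution n p G) {u : EuclideanSpace ℝ (Fin n) → ℂ}
    (hu : IsSmoothPolyharmonicOn p u (unitBall n)) {a : ℝ} (ha : 0 < a) (ha1 : a < 1) :
    ∃ F, AnalyticOnNhd ℂ F (lieDomain n a) ∧ ∀ x, ‖x‖ < a → F (rotVec 0 x) = u x := by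
  obtain ⟨χ, -, -, h⟩ := exists_source (n := n) (p := p) ha (R := (a + 1) / 2) (by linarith)
    (by linarith)
  obtain ⟨h1, h2, h3, h4⟩ := h u hu
  refine ⟨_, hG.analyticOnNhd_integral ha (h1.iterate_laplacian p).continuous h3, fun x hx => ?_⟩
  rw [hG.integral_eq h1 h2, h4 x hx.le]

/-- Polyharmonic functions on the ball extend holomorphically to a neighbourhood of its
rotations. -/
theorem IsSmoothPolyharmonicOn.exists_analyticOnNhd_allRotations (hn : 1 ≤ n) (hp : 1 ≤ p)
    {u : EuclideanSpace ℝ (Fin n) → ℂ} (hu : IsSmoothPolyharmonicOn p u (unitBall n)) :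
    ∃ F, AnalyticOnNhd ℂ F (allRotations n) ∧ ∀ x ∈ unitBall n, F (rotVec 0 x) = u x := by
  obtain ⟨G, hG⟩ := exists_isRadialFundamentalSolution hn hp
  have hex : ∀ a : ℝ, ∃ F, 0 < a → a < 1 → AnalyticOnNhd ℂ F (lieDomain n a) ∧
      ∀ x, ‖x‖ < a → F (rotVec 0 x) = u x := by
    intro a
    by_cases h : 0 < a ∧ a < 1
    · obtain ⟨F, hF⟩ := hu.exists_analyticOnNhd_lieDomain hG h.1 h.2
      exact ⟨F, fun _ _ => hF⟩
    · exact ⟨0, fun h1 h2 => absurd ⟨h1, h2⟩ h⟩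
  choose Φ hΦ using hex
  have hle : ∀ a b, 0 < a → a ≤ b → b < 1 → Set.EqOn (Φ a) (Φ b) (lieDomain n a) := by
    intro a b ha hab hb
    refine (hΦ a ha (hab.trans_lt hb)).1.eqOn_lieDomain ha
      ((hΦ b (ha.trans_le hab) hb).1.mono (lieDomain_mono hab)) fun x hx => ?_
    rw [(hΦ a ha (hab.trans_lt hb)).2 x hx, (hΦ b (ha.trans_le hab) hb).2 x (hx.trans_le hab)]
  -- The domains increase with a and the extensions agree on the smaller one, so the common value
  -- does not depend on a.
  have hglue : ∀ z, ∃ w : ℂ, ∀ a, 0 < a → a < 1 → z ∈ lieDomain n a → Φ a z = w := by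
    intro z
    by_cases h : ∃ b, 0 < b ∧ b < 1 ∧ z ∈ lieDomain n b
    · obtain ⟨b, hb0, hb1, hb⟩ := h
      refine ⟨Φ b z, fun a ha ha1 haz => ?_⟩
      rcases le_total a b with hab | hab
      · exact hle a b ha hab hb1 haz
      · exact (hle b a hb0 hab ha1 hb).symm
    · push Not at h
      exact ⟨0, fun a ha ha1 haz => absurd haz (h a ha ha1)⟩
  choose F hF using hglue
  have hloc : ∀ (ψ : ℝ) (x : EuclideanSpace ℝ (Fin n)), x ∈ unitBall n → ∃ a, 0 < a ∧ a < 1 ∧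
      ‖x‖ < a := by
    intro ψ x hx
    rw [mem_ball_zero_iff] at hx
    exact ⟨(‖x‖ + 1) / 2, by positivity, by linarith, by linarith⟩
  refine ⟨F, ?_, ?_⟩
  · rintro _ ⟨ψ, x, hx, rfl⟩
    obtain ⟨a, ha, ha1, hxa⟩ := hloc ψ x hx
    have hmem := rotVec_mem_lieDomain ψ hxa
    refine ((hΦ a ha ha1).1 _ hmem).congr ?_
    filter_upwards [(isOpen_lieDomain ha).mem_nhds hmem] with z hz
    exact hF z a ha ha1 hz
  · intro x hx
    obtain ⟨a, ha, ha1, hxa⟩ := hloc 0 x hx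
    rw [← hF _ a ha ha1 (rotVec_mem_lieDomain 0 hxa), (hΦ a ha ha1).2 x hxa]

/-- Values of the holomorphic extension are integrals over an annulus in the real ball, against a
smooth kernel. -/
theorem exists_evaluationKernel (hn : 1 ≤ n) (hp : 1 ≤ p) {a : ℝ} (ha : 0 < a) (ha1 : a < 1) :
    ∃ (K : EuclideanSpace ℂ (Fin n) → EuclideanSpace ℝ (Fin n) → ℂ) (r R : ℝ), 0 < r ∧ R < 1 ∧
      ContDiffOn ℝ ∞ (Function.uncurry K) (lieDomain n a ×ˢ Set.univ) ∧
      (∀ z y, ‖y‖ < r ∨ R < ‖y‖ → K z y = 0) ∧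
      ∀ u F, IsSmoothPolyharmonicOn p u (unitBall n) → AnalyticOnNhd ℂ F (allRotations n) →
        (∀ x ∈ unitBall n, F (rotVec 0 x) = u x) → ∀ (ψ : ℝ) (x : EuclideanSpace ℝ (Fin n)),
          ‖x‖ < a → F (rotVec ψ x) = ∫ y, K (rotVec ψ x) y * u y := by
  obtain ⟨G, hG⟩ := exists_isRadialFundamentalSolution hn hp
  -- Radii `a < a₁ < a₂ < b < 1`: evaluation happens inside a, the kernel is switched on between a₁
  -- and a₂, and the source lives between a₂ and b.
  set a₁ := a + (1 - a) / 4 with ha₁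
  set a₂ := a + (1 - a) / 2 with ha₂
  set b := a + 3 * (1 - a) / 4 with hb
  obtain ⟨χ₁, hχ₁, -, hχ₁1, hχ₁0⟩ := exists_contDiff_cutoff (V := EuclideanSpace ℝ (Fin n))
    (r := a₁) (R := a₂) (by linarith) (by linarith)
  obtain ⟨χ, hχ, hχ0, hsrc⟩ := exists_source (n := n) (p := p) (r := a₂) (R := b) (by linarith)
    (by linarith) (by linarith)
  let h : EuclideanSpace ℂ (Fin n) → EuclideanSpace ℝ (Fin n) → ℂ :=
    fun z y => (1 - χ₁ y) * G (sqDist z y)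
  have ho : IsOpen (lieDomain n a ×ˢ (Set.univ : Set (EuclideanSpace ℝ (Fin n)))) :=
    (isOpen_lieDomain ha).prod isOpen_univ
  have hh0 : ∀ y, ‖y‖ < a₁ → ∀ᶠ w in 𝓝 y, ∀ z, h z w = 0 := by
    intro y hy
    filter_upwards [continuous_norm.continuousAt.eventually (gt_mem_nhds hy)] with w hw z
    simp [h, hχ₁1 w (le_of_lt hw)]
  have hsq : ContDiff ℝ ∞ fun q : EuclideanSpace ℂ (Fin n) × EuclideanSpace ℝ (Fin n) =>
      sqDist q.1 q.2 := by
    refine ContDiff.sum fun i _ => ContDiff.pow (ContDiff.sub ?_ ?_) 2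
    · exact ContDiff.comp (ContinuousLinearMap.contDiff ((EuclideanSpace.proj i :
        EuclideanSpace ℂ (Fin n) →L[ℂ] ℂ).restrictScalars ℝ)) contDiff_fst
    · exact Complex.ofRealCLM.contDiff.comp ((EuclideanSpace.proj i :
        EuclideanSpace ℝ (Fin n) →L[ℝ] ℝ).contDiff.comp contDiff_snd)
  have hG' : ContDiffOn ℝ ∞ G Complex.slitPlane :=
    (hG.1.contDiffOn (n := ∞) Complex.isOpen_slitPlane.uniqueDiffOn).restrict_scalars ℝ
  have hh : ContDiffOn ℝ ∞ (Function.uncurry h) (lieDomain n a ×ˢ Set.univ) := by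
    rintro ⟨z, y⟩ ⟨hz, -⟩
    refine ContDiffAt.contDiffWithinAt ?_
    by_cases hy : ‖y‖ < a₁
    · refine (contDiffAt_const (c := (0 : ℂ))).congr_of_eventuallyEq ?_
      filter_upwards [continuousAt_snd.eventually (hh0 y hy)] with q hq
      exact hq q.1
    · have h1 : sqDist z y ∈ Complex.slitPlane :=
        sqDist_mem_slitPlane ha hz (by linarith [not_lt.1 hy])
      have h2 : ContDiffAt ℝ ∞ (fun q : EuclideanSpace ℂ (Fin n) × EuclideanSpace ℝ (Fin n) =>
          G (sqDist q.1 q.2)) (z, y) :=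
        ContDiffAt.comp (z, y) (hG'.contDiffAt (Complex.isOpen_slitPlane.mem_nhds h1))
          hsq.contDiffAt
      exact (contDiffAt_const.sub (hχ₁.contDiffAt.comp (z, y) contDiffAt_snd)).mul h2
  have hΔ := hh.partial_iterate_laplacian (isOpen_lieDomain ha) p
  refine ⟨fun z y => (fun v : EuclideanSpace ℝ (Fin n) → ℂ => Δ v)^[p] (h z) y * χ y, a₁, b,
    by linarith, by linarith, ?_, ?_, ?_⟩
  · exact hΔ.mul (hχ.comp contDiff_snd).contDiffOn
  · rintro z y (hy | hy)
    · have h1 : h z =ᶠ[𝓝 y] 0 := (hh0 y hy).mono fun w hw => hw z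
      simp only []
      rw [(h1.iterate_laplacian p).eq_of_nhds, iterate_laplacian_zero]
      simp
    · simp [hχ0 y hy.le]
  · intro u F hu hF hFu ψ x hx
    obtain ⟨hu1, hu2, hu3, hu4⟩ := hsrc u hu
    have hxa : ∀ t : ℝ, |t| ≤ 1 → ‖t • x‖ < a := fun t ht => by
      rw [norm_smul]
      exact (mul_le_of_le_one_left (norm_nonneg _) ht).trans_lt hx
    have h1 := hG.analyticOnNhd_integral (r := a₂) (by linarith)
      (hu1.iterate_laplacian p).continuous hu3
    have hball : ∀ t : ℝ, |t| ≤ 1 → t • x ∈ unitBall n := fun t ht => by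
      rw [mem_ball_zero_iff]; linarith [hxa t ht]
    rw [eq_rotVec_of_eq_real (F := F)
      (fun ψ t ht => hF _ (rotVec_mem_allRotations ψ (hball t ht)))
      (fun ψ t ht => h1 _ (rotVec_mem_lieDomain ψ (by linarith [hxa t ht]))) ?_ ψ]
    · have hz : rotVec ψ x ∈ lieDomain n a := rotVec_mem_lieDomain ψ hx
      have hhz : ContDiff ℝ ∞ (h (rotVec ψ x)) :=
        hh.comp_contDiff (contDiff_prodMk_right _) fun y => ⟨hz, Set.mem_univ _⟩
      have h2 := integral_mul_iterate_laplacian_comm hhz hu1 (Or.inr hu2) p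
      simp only [mul_assoc]
      rw [← h2]
      -- Where the source can be nonzero, `|y| ≥ a₂`, so `χ₁ = 0` and h is the original kernel;
      -- removing the singularity has changed nothing.
      refine integral_congr_ae (Eventually.of_forall fun y => ?_)
      by_cases hy : ‖y‖ < a₂
      · simp only [hu3 y (Or.inl hy), mul_zero]
      · simp only [h, hχ₁0 y (not_lt.1 hy), sub_zero, one_mul]
    · intro t ht
      rw [hFu _ (hball t ht), hG.integral_eq hu1 hu2, hu4 _ (by linarith [hxa t ht])]

end Representation

/-! ### The weighted measure and integrals over real annuli -/

section HatMeasure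

open Filter Topology
open scoped ENNReal

variable {n p : ℕ} {α β : ℝ}

theorem continuous_rot (k : Fin p) : Continuous (rot k : unitBall n → hatB n p) :=
  ((continuous_rotVec _).comp continuous_subtype_val).subtype_mk _

theorem measurable_weight : Measurable (weight α β : EuclideanSpace ℝ (Fin n) → ℝ) := by
  unfold weight
  exact ((measurable_norm.pow_const α)).mul
    ((measurable_const.sub (measurable_norm.pow_const 2)).pow_const β)

theorem weight_nonneg (y : unitBall n) : 0 ≤ weight α β (y : EuclideanSpace ℝ (Fin n)) := by
  have hy : ‖(y : EuclideanSpace ℝ (Fin n))‖ < 1 := mem_ball_zero_iff.1 y.2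
  have : 0 ≤ 1 - ‖(y : EuclideanSpace ℝ (Fin n))‖ ^ 2 := by
    nlinarith [norm_nonneg (y : EuclideanSpace ℝ (Fin n))]
  unfold weight
  positivity

theorem measurable_ofReal_weight : Measurable fun y : unitBall n =>
    ENNReal.ofReal (weight α β (y : EuclideanSpace ℝ (Fin n))) :=
  ENNReal.measurable_ofReal.comp (measurable_weight.comp measurable_subtype_coe)

theorem integral_hatMeasure (hp : 1 ≤ p) {f : hatB n p → ℂ} (hf : Integrable f (hatMeasure n p α β)) :
    ∫ z, f z ∂(hatMeasure n p α β) = (1 / (p : ℂ)) * ∑ k : Fin p, ∫ y,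
      f (rot k y) * ((weight α β (y : EuclideanSpace ℝ (Fin n)) : ℝ) : ℂ) ∂(ballVolume n) := by
  have hp0 : (p : ℝ≥0∞) ≠ 0 := by exact_mod_cast (by omega : p ≠ 0)
  have hsum : Integrable f (∑ k : Fin p, ((ballVolume n).withDensity
      (fun y => ENNReal.ofReal (weight α β (y : EuclideanSpace ℝ (Fin n))))).map (rot k)) := by
    have := hf.smul_measure (ENNReal.natCast_ne_top p)
    rwa [hatMeasure, smul_smul, ENNReal.mul_inv_cancel hp0 (ENNReal.natCast_ne_top p),
      one_smul] at this
  rw [integrable_finsetSum_measure] at hsum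
  rw [hatMeasure, integral_smul_measure, integral_finsetSum_measure hsum]
  rw [Complex.real_smul]
  congr 1
  · simp
  · refine Finset.sum_congr rfl fun k _ => ?_
    rw [integral_map (continuous_rot k).aemeasurable (hsum k (Finset.mem_univ k)).1,
      integral_withDensity_eq_integral_toReal_smul measurable_ofReal_weight
        (Eventually.of_forall fun _ => ENNReal.ofReal_lt_top)]
    refine integral_congr_ae (Eventually.of_forall fun y => ?_)
    simp only [ENNReal.toReal_ofReal (weight_nonneg y), Complex.real_smul]
    ring

theorem hatInner_eq_integral (hp : 1 ≤ p) {u v : hatB n p → ℂ} (hu : MemLp u 2 (hatMeasure n p α β))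
    (hv : MemLp v 2 (hatMeasure n p α β)) :
    hatInner α β u v = ∫ z, u z * (starRingEnd ℂ) (v z) ∂(hatMeasure n p α β) := by
  rw [integral_hatMeasure hp (f := fun z => u z * (starRingEnd ℂ) (v z))
    (hu.integrable_mul (MemLp.star hv))]
  rfl

/-- The arguments swap because `inner` is conjugate-linear in its first slot and `hatInner` in its
second. -/
theorem inner_eq_hatInner (hp : 1 ≤ p) (f g : HatL2 n p α β) :
    inner ℂ g f = hatInner α β f g := by
  rw [hatInner_eq_integral hp (Lp.memLp f) (Lp.memLp g), L2.inner_def]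
  rfl

theorem hatInner_congr_ae (hp : 1 ≤ p) {u u' v v' : hatB n p → ℂ}
    (hu : MemLp u 2 (hatMeasure n p α β)) (hv : MemLp v 2 (hatMeasure n p α β))
    (huu' : u =ᵐ[hatMeasure n p α β] u') (hvv' : v =ᵐ[hatMeasure n p α β] v') :
    hatInner α β u v = hatInner α β u' v' := by
  rw [hatInner_eq_integral hp hu hv, hatInner_eq_integral hp ((memLp_congr_ae huu').1 hu)
    ((memLp_congr_ae hvv').1 hv)]
  refine integral_congr_ae ?_
  filter_upwards [huu', hvv'] with z h1 h2
  rw [h1, h2]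

/-- The annulus is compact and avoids the origin and the unit sphere, where the weight may
degenerate. -/
theorem exists_le_weight {r R : ℝ} (hr : 0 < r) (hR : R < 1) :
    ∃ c, 0 < c ∧ ∀ y ∈ annulus n r R, c ≤ weight α β y := by
  have hcont : ContinuousOn (weight α β) (annulus n r R) := by
    unfold weight
    refine ContinuousOn.mul (ContinuousOn.rpow_const continuous_norm.continuousOn fun y hy =>
      Or.inl (hr.trans_le hy.1).ne') (ContinuousOn.rpow_const (by fun_prop) fun y hy =>
      Or.inl ?_)
    nlinarith [norm_nonneg y, hy.2]
  have hpos : ∀ y ∈ annulus n r R, 0 < weight α β y := by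
    intro y hy
    have h1 : 0 < ‖y‖ := hr.trans_le hy.1
    have h2 : 0 < 1 - ‖y‖ ^ 2 := by nlinarith [hy.2]
    unfold weight
    positivity
  rcases (annulus n r R).eq_empty_or_nonempty with h | h
  · exact ⟨1, one_pos, by simp [h]⟩
  · obtain ⟨y, hy, hmin⟩ := (isCompact_annulus r R).exists_isMinOn h hcont
    exact ⟨_, hpos y hy, fun z hz => hmin hz⟩

/-- By the lower bound for the weight, one of the p summands of the measure dominates unweighted
Lebesgue measure on the annulus. -/
theorem exists_map_restrict_le_smul_hatMeasure (k : Fin p) {r R : ℝ} (hr : 0 < r) (hR : R < 1) :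
    ∃ c : ℝ≥0∞, c ≠ 0 ∧ c ≠ ∞ ∧
      ((ballVolume n).restrict (Subtype.val ⁻¹' annulus n r R)).map (rot k) ≤
        c • hatMeasure n p α β := by
  obtain ⟨c, hc, hw⟩ := exists_le_weight (n := n) (α := α) (β := β) hr hR
  have hp : p ≠ 0 := fun h => by subst h; exact k.elim0
  have hp0 : (p : ℝ≥0∞) ≠ 0 := by exact_mod_cast hp
  have hc0 : ENNReal.ofReal c ≠ 0 := by simpa using hc
  have hA : MeasurableSet (Subtype.val ⁻¹' annulus n r R : Set (unitBall n)) :=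
    measurable_subtype_coe (isCompact_annulus r R).measurableSet
  set ν := (ballVolume n).withDensity
    (fun y => ENNReal.ofReal (weight α β (y : EuclideanSpace ℝ (Fin n)))) with hν
  have h1 : ENNReal.ofReal c • (ballVolume n).restrict (Subtype.val ⁻¹' annulus n r R) ≤ ν := by
    rw [← withDensity_const, ← withDensity_indicator hA]
    refine withDensity_mono (Eventually.of_forall fun y => ?_)
    by_cases hy : y ∈ (Subtype.val ⁻¹' annulus n r R : Set (unitBall n))
    · simp only [Set.indicator_of_mem hy]
      exact ENNReal.ofReal_le_ofReal (hw y hy)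
    · rw [Set.indicator_of_notMem hy]
      exact zero_le
  have h2 : (ballVolume n).restrict (Subtype.val ⁻¹' annulus n r R) ≤
      (ENNReal.ofReal c)⁻¹ • ν := by
    calc _ = (ENNReal.ofReal c)⁻¹ • ENNReal.ofReal c •
          (ballVolume n).restrict (Subtype.val ⁻¹' annulus n r R) := by
          rw [smul_smul, ENNReal.inv_mul_cancel hc0 ENNReal.ofReal_ne_top, one_smul]
      _ ≤ _ := by gcongr
  have h3 : ν.map (rot k) ≤ (p : ℝ≥0∞) • hatMeasure n p α β := by
    rw [hatMeasure, smul_smul, ENNReal.mul_inv_cancel hp0 (ENNReal.natCast_ne_top p), one_smul]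
    intro s
    rw [Measure.finsetSum_apply]
    exact Finset.single_le_sum (f := fun k : Fin p => (ν.map (rot k)) s) (fun _ _ => zero_le)
      (Finset.mem_univ k)
  refine ⟨(ENNReal.ofReal c)⁻¹ * p, mul_ne_zero (by simp) hp0,
    ENNReal.mul_ne_top (ENNReal.inv_ne_top.2 hc0) (ENNReal.natCast_ne_top p), ?_⟩
  calc _ ≤ ((ENNReal.ofReal c)⁻¹ • ν).map (rot k) :=
        Measure.map_mono h2 (continuous_rot k).measurable
    _ = (ENNReal.ofReal c)⁻¹ • ν.map (rot k) := Measure.map_smul _ _ _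
    _ ≤ (ENNReal.ofReal c)⁻¹ • (p : ℝ≥0∞) • hatMeasure n p α β := by gcongr
    _ = _ := by rw [smul_smul]

open Classical in
/-- The restriction to the real ball of a function on the union of the rotated balls. -/
noncomputable def ballValues (f : hatB n p → ℂ) (y : EuclideanSpace ℝ (Fin n)) : ℂ :=
  if h : rotVec 0 y ∈ hatB n p then f ⟨rotVec 0 y, h⟩ else 0

theorem rot_zero_coe (hp : 0 < p) (y : unitBall n) :
    (rot ⟨0, hp⟩ y : EuclideanSpace ℂ (Fin n)) = rotVec 0 y := by
  simp [rot]

theorem rotVec_zero_mem_hatB (hp : 0 < p) {y : EuclideanSpace ℝ (Fin n)} (hy : y ∈ unitBall n) :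
    rotVec 0 y ∈ hatB n p := by
  rw [← rot_zero_coe hp ⟨y, hy⟩]
  exact Subtype.coe_prop _

theorem ballValues_coe (hp : 0 < p) (f : hatB n p → ℂ) (y : unitBall n) :
    ballValues f y = f (rot ⟨0, hp⟩ y) := by
  rw [ballValues, dif_pos (rotVec_zero_mem_hatB hp y.2)]
  exact congrArg f (Subtype.ext (rot_zero_coe hp y).symm)

theorem ballValues_sub (f g : hatB n p → ℂ) : ballValues (f - g) = ballValues f - ballValues g := by
  ext y
  by_cases h : rotVec 0 y ∈ hatB n p <;> simp [ballValues, h]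

/-- Square integrable functions on the union of the rotated balls restrict to integrable functions
on annuli in the real ball. -/
theorem exists_integral_norm_ballValues_le (hp : 0 < p) {r R : ℝ} (hr : 0 < r) (hR : R < 1) :
    ∃ C : ℝ, 0 ≤ C ∧ ∀ f : hatB n p → ℂ, MemLp f 2 (hatMeasure n p α β) →
      IntegrableOn (ballValues f) (annulus n r R) ∧
      ∫ y in annulus n r R, ‖ballValues f y‖ ≤ C * (eLpNorm f 2 (hatMeasure n p α β)).toReal := by
  obtain ⟨c, hc0, hc, hle⟩ := exists_map_restrict_le_smul_hatMeasure (n := n) (α := α) (β := β)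
    (⟨0, hp⟩ : Fin p) hr hR
  set A : Set (unitBall n) := Subtype.val ⁻¹' annulus n r R
  have hB : MeasurableSet (unitBall n) := Metric.isOpen_ball.measurableSet
  have hemb : MeasurableEmbedding (Subtype.val : unitBall n → EuclideanSpace ℝ (Fin n)) :=
    MeasurableEmbedding.subtype_coe hB
  have hAB : annulus n r R ⊆ unitBall n := fun y hy => by
    rw [mem_ball_zero_iff]; exact hy.2.trans_lt hR
  have hmeas : (volume.restrict (annulus n r R) : Measure (EuclideanSpace ℝ (Fin n))) =
      ((ballVolume n).restrict A).map Subtype.val := by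
    rw [← hemb.restrict_map]
    unfold ballVolume
    rw [map_comap_subtype_coe hB, Measure.restrict_restrict_of_subset hAB]
  have hfin : ((ballVolume n).restrict A) Set.univ ≠ ∞ := by
    have h1 := congrArg (fun μ => μ Set.univ) hmeas
    simp only [Measure.map_apply measurable_subtype_coe MeasurableSet.univ, Set.preimage_univ] at h1
    rw [← h1, Measure.restrict_apply_univ]
    exact (isCompact_annulus r R).measure_ne_top
  have hcoe : ∀ f : hatB n p → ℂ, ballValues f ∘ (Subtype.val : unitBall n → _) =
      f ∘ rot ⟨0, hp⟩ := fun f => funext fun y => ballValues_coe hp f y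
  -- The first factor is the cost of comparing the measures in L²; the second is Hölder's constant
  -- from L² to L¹ on the annulus, which has finite measure.
  set D := c ^ (1 / (2 : ℝ≥0∞)).toReal *
    ((ballVolume n).restrict A) Set.univ ^ (1 / (1 : ℝ≥0∞).toReal - 1 / (2 : ℝ≥0∞).toReal) with hD
  have hDtop : D ≠ ∞ := by
    refine ENNReal.mul_ne_top (ENNReal.rpow_ne_top_of_nonneg ENNReal.toReal_nonneg hc)
      (ENNReal.rpow_ne_top_of_nonneg ?_ hfin)
    norm_num
  refine ⟨D.toReal, ENNReal.toReal_nonneg, fun f hf => ?_⟩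
  have hf1 : MemLp f 2 (((ballVolume n).restrict A).map (rot ⟨0, hp⟩)) :=
    hf.of_measure_le_smul hc hle
  have hf2 : AEStronglyMeasurable (f ∘ rot ⟨0, hp⟩) ((ballVolume n).restrict A) :=
    hf1.1.comp_measurable (continuous_rot _).measurable
  have hbound : eLpNorm (ballValues f) 1 (volume.restrict (annulus n r R)) ≤
      D * eLpNorm f 2 (hatMeasure n p α β) := by
    rw [hmeas, hemb.eLpNorm_map_measure, hcoe]
    refine (eLpNorm_le_eLpNorm_mul_rpow_measure_univ (q := 2) (by norm_num) hf2).trans ?_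
    rw [← eLpNorm_map_measure hf1.1 (continuous_rot _).aemeasurable, hD, mul_right_comm]
    gcongr
    refine (eLpNorm_mono_measure f hle).trans ?_
    rw [eLpNorm_smul_measure_of_ne_zero hc0, smul_eq_mul]
  have hfin2 : D * eLpNorm f 2 (hatMeasure n p α β) ≠ ∞ := ENNReal.mul_ne_top hDtop hf.2.ne
  have hmem : AEStronglyMeasurable (ballValues f) (volume.restrict (annulus n r R)) := by
    rw [hmeas, hemb.aestronglyMeasurable_map_iff, hcoe]
    exact hf2
  refine ⟨memLp_one_iff_integrable.1 ⟨hmem, hbound.trans_lt hfin2.lt_top⟩, ?_⟩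
  rw [integral_norm_eq_lintegral_enorm hmem, ← eLpNorm_one_eq_lintegral_enorm,
    ← ENNReal.toReal_mul]
  exact ENNReal.toReal_mono hfin2 hbound

theorem exists_norm_integral_mul_ballValues_le (hp : 0 < p) {r R : ℝ} (hr : 0 < r) (hR : R < 1) :
    ∃ C : ℝ, 0 ≤ C ∧ ∀ f : hatB n p → ℂ, MemLp f 2 (hatMeasure n p α β) →
      ∀ (κ : EuclideanSpace ℝ (Fin n) → ℂ) (M : ℝ), Continuous κ → (∀ y, ‖κ y‖ ≤ M) →
        (∀ y, ‖y‖ < r ∨ R < ‖y‖ → κ y = 0) → Integrable (fun y => κ y * ballValues f y) ∧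
          ‖∫ y, κ y * ballValues f y‖ ≤ M * (C * (eLpNorm f 2 (hatMeasure n p α β)).toReal) := by
  obtain ⟨C, hC, h⟩ := exists_integral_norm_ballValues_le (n := n) (α := α) (β := β) hp hr hR
  refine ⟨C, hC, fun f hf κ M hκ hM h0 => ?_⟩
  obtain ⟨h1, h2⟩ := h f hf
  have hzero : ∀ y ∉ annulus n r R, κ y * ballValues f y = 0 := by
    intro y hy
    rw [h0 y (lt_or_lt_of_notMem_annulus hy), zero_mul]
  have hint : IntegrableOn (fun y => κ y * ballValues f y) (annulus n r R) :=
    Integrable.bdd_mul h1 hκ.aestronglyMeasurable (Eventually.of_forall hM)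
  refine ⟨(integrableOn_iff_integrable_of_support_subset fun y hy => ?_).1 hint, ?_⟩
  · by_contra hcon
    exact hy (hzero y hcon)
  · rw [← setIntegral_eq_integral_of_forall_compl_eq_zero hzero]
    have hM0 : 0 ≤ M := (norm_nonneg _).trans (hM 0)
    calc ‖∫ y in annulus n r R, κ y * ballValues f y‖
        ≤ ∫ y in annulus n r R, M * ‖ballValues f y‖ := by
          refine norm_integral_le_of_norm_le (h1.norm.const_mul M) (Eventually.of_forall fun y => ?_)
          rw [norm_mul]
          gcongr
          exact hM y
      _ = M * ∫ y in annulus n r R, ‖ballValues f y‖ := integral_const_mul _ _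
      _ ≤ _ := by gcongr

end HatMeasure

/-! ### Bounded point evaluations and limits in the Bergman space -/

section Limits

open Laplacian Filter Topology
open scoped ContDiff

variable {n p : ℕ} {α β : ℝ}

theorem IsPolyharmonicOn.isSmoothPolyharmonicOn {u : EuclideanSpace ℝ (Fin n) → ℂ}
    {s : Set (EuclideanSpace ℝ (Fin n))} (hs : IsOpen s) (hu : IsPolyharmonicOn p u s) :
    IsSmoothPolyharmonicOn p u s :=
  ⟨hu.1.contDiffOn hs.uniqueDiffOn, hu.2⟩

theorem iterate_laplacian_add_of_isOpen {V : Type*} [NormedAddCommGroup V] [InnerProductSpace ℝ V]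
    [FiniteDimensional ℝ V] {s : Set V} (hs : IsOpen s) {u v : V → ℂ} (hu : ContDiffOn ℝ ∞ u s)
    (hv : ContDiffOn ℝ ∞ v s) (q : ℕ) : ∀ x ∈ s, (fun v : V → ℂ => Δ v)^[q] (u + v) x =
      (fun v : V → ℂ => Δ v)^[q] u x + (fun v : V → ℂ => Δ v)^[q] v x := by
  induction q with
  | zero => exact fun _ _ => rfl
  | succ q ih =>
    intro x hx
    simp only [Function.iterate_succ_apply']
    have h1 : (fun v : V → ℂ => Δ v)^[q] (u + v) =ᶠ[𝓝 x]
        (fun v : V → ℂ => Δ v)^[q] u + (fun v : V → ℂ => Δ v)^[q] v := by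
      filter_upwards [hs.mem_nhds hx] with y hy using ih y hy
    rw [(InnerProductSpace.laplacian_congr_nhds h1).eq_of_nhds]
    exact (((hu.iterate_laplacian hs q).contDiffAt (hs.mem_nhds hx)).of_le
      (by norm_cast)).laplacian_add
      (((hv.iterate_laplacian hs q).contDiffAt (hs.mem_nhds hx)).of_le (by norm_cast))

theorem iterate_laplacian_smul_of_isOpen {V : Type*} [NormedAddCommGroup V] [InnerProductSpace ℝ V]
    [FiniteDimensional ℝ V] {s : Set V} (hs : IsOpen s) {u : V → ℂ} (hu : ContDiffOn ℝ ∞ u s)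
    (c : ℂ) (q : ℕ) : ∀ x ∈ s, (fun v : V → ℂ => Δ v)^[q] (c • u) x =
      c * (fun v : V → ℂ => Δ v)^[q] u x := by
  induction q with
  | zero => exact fun _ _ => rfl
  | succ q ih =>
    intro x hx
    simp only [Function.iterate_succ_apply']
    have h1 : (fun v : V → ℂ => Δ v)^[q] (c • u) =ᶠ[𝓝 x] c • (fun v : V → ℂ => Δ v)^[q] u := by
      filter_upwards [hs.mem_nhds hx] with y hy using ih y hy
    rw [(InnerProductSpace.laplacian_congr_nhds h1).eq_of_nhds]
    exact InnerProductSpace.laplacian_smul c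
      (((hu.iterate_laplacian hs q).contDiffAt (hs.mem_nhds hx)).of_le (by norm_cast))

/-- The weighted polyharmonic Bergman space as a space of functions. -/
def bergmanSubmodule (n p : ℕ) (α β : ℝ) : Submodule ℂ (hatB n p → ℂ) where
  carrier := bergman n p α β
  zero_mem' := by
    refine ⟨⟨0, ⟨fun _ _ => analyticAt_const, fun x _ => ?_⟩, 0, fun _ _ => analyticAt_const,
      fun _ _ => rfl, fun _ => rfl⟩, MemLp.zero⟩
    exact congrFun (iterate_laplacian_zero p) x
  add_mem' := by
    rintro w w' ⟨⟨u, hu, F, hF, hFu, hFw⟩, hw⟩ ⟨⟨u', hu', F', hF', hFu', hFw'⟩, hw'⟩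
    refine ⟨⟨u + u', ⟨hu.1.add hu'.1, fun x hx => ?_⟩, F + F', hF.add hF',
      fun x hx => by simp [hFu x hx, hFu' x hx], fun z => by simp [hFw, hFw']⟩, hw.add hw'⟩
    rw [iterate_laplacian_add_of_isOpen Metric.isOpen_ball
      (hu.isSmoothPolyharmonicOn Metric.isOpen_ball).1
      (hu'.isSmoothPolyharmonicOn Metric.isOpen_ball).1 p x hx, hu.2 x hx, hu'.2 x hx, add_zero]
  smul_mem' := by
    rintro c w ⟨⟨u, hu, F, hF, hFu, hFw⟩, hw⟩
    refine ⟨⟨c • u, ⟨fun x hx => (hu.1 x hx).const_smul, fun x hx => ?_⟩, c • F,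
      fun z hz => (hF z hz).const_smul,
      fun x hx => by simp [hFu x hx], fun z => by simp [hFw]⟩, hw.const_smul c⟩
    rw [iterate_laplacian_smul_of_isOpen Metric.isOpen_ball
      (hu.isSmoothPolyharmonicOn Metric.isOpen_ball).1 c p x hx, hu.2 x hx, mul_zero]

theorem hatB_subset_allRotations : hatB n p ⊆ allRotations n := by
  intro z hz
  obtain ⟨k, x, hx, rfl⟩ := Set.mem_iUnion.1 hz
  exact ⟨_, x, hx, rfl⟩

theorem existsUnique_isRotExtension (hn : 1 ≤ n) (hp : 1 ≤ p) {u : EuclideanSpace ℝ (Fin n) → ℂ}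
    (hu : IsPolyharmonicOn p u (unitBall n)) : ∃! w : hatB n p → ℂ, IsRotExtension u w := by
  obtain ⟨F, hF, hFu⟩ :=
    (hu.isSmoothPolyharmonicOn Metric.isOpen_ball).exists_analyticOnNhd_allRotations hn hp
  refine ⟨fun z => F z, ⟨F, hF, hFu, fun _ => rfl⟩, ?_⟩
  rintro w ⟨F', hF', hFu', hFw'⟩
  funext z
  rw [← hFw' z]
  exact hF'.eqOn_allRotations hF (fun x hx => by rw [hFu x hx, hFu' x hx])
    (hatB_subset_allRotations z.2)

/-- Elements of the Bergman space, as functions on the real ball together with their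
holomorphic extensions. -/
theorem exists_extension_of_mem_bergman (hp : 1 ≤ p) {w : hatB n p → ℂ} (hw : w ∈ bergman n p α β) :
    IsSmoothPolyharmonicOn p (ballValues w) (unitBall n) ∧
      ∃ F, AnalyticOnNhd ℂ F (allRotations n) ∧
        (∀ x ∈ unitBall n, F (rotVec 0 x) = ballValues w x) ∧ ∀ z : hatB n p, F z = w z := by
  obtain ⟨⟨u, hu, F, hF, hFu, hFw⟩, -⟩ := hw
  have heq : ∀ x ∈ unitBall n, ballValues w x = u x := by
    intro x hx
    rw [ballValues_coe hp w ⟨x, hx⟩, ← hFw, rot_zero_coe, hFu x hx]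
  have hu' := hu.isSmoothPolyharmonicOn Metric.isOpen_ball
  refine ⟨⟨hu'.1.congr heq, fun x hx => ?_⟩, F, hF, fun x hx => by rw [hFu x hx, heq x hx], hFw⟩
  have h1 : ballValues w =ᶠ[𝓝 x] u := by
    filter_upwards [Metric.isOpen_ball.mem_nhds hx] with y hy using heq y hy
  rw [(h1.iterate_laplacian p).eq_of_nhds, hu.2 x hx]

/-- As u is smooth only inside the ball, it is multiplied by a cut-off equal to 1 near the support
of φ, which changes neither integral. -/
theorem integral_mul_iterate_laplacian_of_contDiffOn {u φ : EuclideanSpace ℝ (Fin n) → ℂ}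
    (hu : ContDiffOn ℝ ∞ u (unitBall n)) (hφ : ContDiff ℝ ∞ φ) {r : ℝ} (hr0 : 0 < r) (hr : r < 1)
    (hs : tsupport φ ⊆ Metric.closedBall 0 r) (q : ℕ) :
    ∫ x, φ x * (fun v : EuclideanSpace ℝ (Fin n) → ℂ => Δ v)^[q] u x =
      ∫ x, (fun v : EuclideanSpace ℝ (Fin n) → ℂ => Δ v)^[q] φ x * u x := by
  obtain ⟨χ, h1, h2, h3, h4⟩ := exists_contDiff_cutoff (V := EuclideanSpace ℝ (Fin n))
    (r := (2 * r + 1) / 3) (R := (r + 2) / 3) (by linarith) (by linarith)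
  have hc : HasCompactSupport φ :=
    HasCompactSupport.of_support_subset_isCompact (isCompact_closedBall 0 r)
      ((subset_tsupport _).trans hs)
  have hχu := contDiff_mul_of_tsupport_subset Metric.isOpen_ball h1 hu
    (h2.trans (Metric.closedBall_subset_ball (by linarith)))
  have h5 := integral_mul_iterate_laplacian_comm hφ hχu (Or.inl hc) q
  have hin : ∀ x ∈ tsupport φ, ‖x‖ < (2 * r + 1) / 3 := fun x hx => by
    have := mem_closedBall_zero_iff.1 (hs hx)
    linarith
  calc _ = _ := integral_congr_ae (Eventually.of_forall fun x => ?_)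
    _ = _ := h5
    _ = _ := integral_congr_ae (Eventually.of_forall fun x => ?_)
  · by_cases hx : x ∈ tsupport φ
    · have h6 : (fun y => χ y * u y) =ᶠ[𝓝 x] u := by
        filter_upwards [continuous_norm.continuousAt.eventually (gt_mem_nhds (hin x hx))] with w hw
        rw [h3 w (le_of_lt hw), one_mul]
      simp only [(h6.iterate_laplacian q).eq_of_nhds]
    · simp only [image_eq_zero_of_notMem_tsupport hx, zero_mul]
  · by_cases hx : x ∈ tsupport φ
    · simp only [h3 x (hin x hx).le, one_mul]
    · simp only [image_eq_zero_of_notMem_tsupport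
        (fun h => hx (tsupport_iterate_laplacian_subset φ q h)), zero_mul]

/-- The value at z, on whichever rotated ball, is an integral over a real annulus against a bounded
kernel, and the L² norm controls that integral. -/
theorem exists_norm_le_of_mem_bergman (hn : 1 ≤ n) (hp : 1 ≤ p) (z : hatB n p) :
    ∃ C : ℝ, 0 ≤ C ∧ ∀ w ∈ bergman n p α β,
      ‖w z‖ ≤ C * (eLpNorm w 2 (hatMeasure n p α β)).toReal := by
  obtain ⟨k, x, hx, hz⟩ := Set.mem_iUnion.1 z.2
  have hx1 := mem_ball_zero_iff.1 hx
  obtain ⟨K, r, R, hr, hR, hK, hK0, hrep⟩ := exists_evaluationKernel (n := n) (p := p) hn hp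
    (a := (‖x‖ + 1) / 2) (by positivity) (by linarith)
  obtain ⟨C, hC, hbd⟩ := exists_norm_integral_mul_ballValues_le (n := n) (α := α) (β := β) hp hr hR
  have hmem : (z : EuclideanSpace ℂ (Fin n)) ∈ lieDomain n ((‖x‖ + 1) / 2) := by
    rw [← hz]; exact rotVec_mem_lieDomain _ (by linarith)
  have hcont : Continuous (K z) :=
    (hK.comp_contDiff (contDiff_prodMk_right _) fun y => ⟨hmem, Set.mem_univ _⟩).continuous
  obtain ⟨M, hM⟩ := hcont.bounded_above_of_compact_support
    (HasCompactSupport.of_support_subset_isCompact (isCompact_annulus r R) fun y hy =>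
      by_contra fun h => hy (hK0 z y (lt_or_lt_of_notMem_annulus h)))
  refine ⟨|M| * C, by positivity, fun w hw => ?_⟩
  obtain ⟨h1, F, hF, hFu, hFw⟩ := exists_extension_of_mem_bergman hp hw
  have h2 := hrep _ F h1 hF hFu (k * Real.pi / p) x (by linarith)
  rw [hz, hFw z] at h2
  rw [h2, mul_assoc]
  exact (hbd w hw.2 (K z) |M| hcont (fun y => (hM y).trans (le_abs_self M)) (hK0 z)).2

/-- The evaluation bound applied to u - v, whose norm is zero. -/
theorem eq_of_ae_eq_of_mem_bergman (hn : 1 ≤ n) (hp : 1 ≤ p) {u v : hatB n p → ℂ}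
    (hu : u ∈ bergman n p α β) (hv : v ∈ bergman n p α β) (h : u =ᵐ[hatMeasure n p α β] v) :
    u = v := by
  funext z
  obtain ⟨C, -, hC⟩ := exists_norm_le_of_mem_bergman (α := α) (β := β) hn hp z
  have h1 := hC (u - v) ((bergmanSubmodule n p α β).sub_mem hu hv)
  have h2 : eLpNorm (u - v) 2 (hatMeasure n p α β) = 0 := by
    rw [eLpNorm_congr_ae (g := 0)]
    · exact eLpNorm_zero
    · filter_upwards [h] with x hx
      simp [hx]
  rw [h2] at h1
  simpa [sub_eq_zero] using h1

/-- The `L²` limit of a sequence in the Bergman space, if it is also a pointwise limit, lies in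
the Bergman space. -/
theorem mem_bergman_of_tendsto (hn : 1 ≤ n) (hp : 1 ≤ p) {w : ℕ → hatB n p → ℂ}
    {v : hatB n p → ℂ} (hw : ∀ m, w m ∈ bergman n p α β) (hv : MemLp v 2 (hatMeasure n p α β))
    (hlim : Tendsto (fun m => (eLpNorm (w m - v) 2 (hatMeasure n p α β)).toReal) atTop (𝓝 0))
    (hpt : ∀ z, Tendsto (fun m => w m z) atTop (𝓝 (v z))) : v ∈ bergman n p α β := by
  -- integral formula for the limit
  have hker : ∀ {r R : ℝ}, 0 < r → R < 1 → ∀ κ : EuclideanSpace ℝ (Fin n) → ℂ, Continuous κ →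
      (∀ y, ‖y‖ < r ∨ R < ‖y‖ → κ y = 0) →
      Tendsto (fun m => ∫ y, κ y * ballValues (w m) y) atTop (𝓝 (∫ y, κ y * ballValues v y)) := by
    intro r R hr hR κ hκ h0
    obtain ⟨C, hC, hbd⟩ := exists_norm_integral_mul_ballValues_le (n := n) (α := α) (β := β) hp hr hR
    obtain ⟨M, hM⟩ := hκ.bounded_above_of_compact_support
      (HasCompactSupport.of_support_subset_isCompact (isCompact_annulus r R) fun y hy =>
        by_contra fun h => hy (h0 y (lt_or_lt_of_notMem_annulus h)))
    rw [tendsto_iff_norm_sub_tendsto_zero]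
    refine squeeze_zero (fun _ => norm_nonneg _) (fun m => ?_)
      (by simpa using (hlim.const_mul C).const_mul M)
    have h1 := (hbd (w m - v) ((hw m).2.sub hv) κ M hκ hM h0).2
    rw [← integral_sub (hbd _ (hw m).2 κ M hκ hM h0).1 (hbd _ hv κ M hκ hM h0).1]
    simpa [ballValues_sub, mul_sub] using h1
  have hext := fun m => exists_extension_of_mem_bergman hp (hw m)
  choose hsm F hF hFu hFw using hext
  -- the limit on the real ball is given by the evaluation kernel
  have hrepv : ∀ {a : ℝ} {K : EuclideanSpace ℂ (Fin n) → EuclideanSpace ℝ (Fin n) → ℂ} {r R : ℝ},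
      0 < r → R < 1 → ContDiffOn ℝ ∞ (Function.uncurry K) (lieDomain n a ×ˢ Set.univ) →
      (∀ z y, ‖y‖ < r ∨ R < ‖y‖ → K z y = 0) →
      (∀ u F, IsSmoothPolyharmonicOn p u (unitBall n) → AnalyticOnNhd ℂ F (allRotations n) →
        (∀ x ∈ unitBall n, F (rotVec 0 x) = u x) → ∀ (ψ : ℝ) (x : EuclideanSpace ℝ (Fin n)),
          ‖x‖ < a → F (rotVec ψ x) = ∫ y, K (rotVec ψ x) y * u y) →
      ∀ (ψ : ℝ) (x : EuclideanSpace ℝ (Fin n)), ‖x‖ < a → ∀ z : hatB n p, z = rotVec ψ x →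
        v z = ∫ y, K (rotVec ψ x) y * ballValues v y := by
    intro a K r R hr hR hK hK0 hrep ψ x hx z hz
    have hcont : Continuous (K (rotVec ψ x)) :=
      (hK.comp_contDiff (contDiff_prodMk_right _)
        fun y => ⟨rotVec_mem_lieDomain ψ hx, Set.mem_univ _⟩).continuous
    refine tendsto_nhds_unique (hpt z) ((hker hr hR _ hcont (hK0 _)).congr fun m => ?_)
    rw [← hFw m z, hz]
    exact (hrep _ _ (hsm m) (hF m) (hFu m) ψ x hx).symm
  have hsmooth : ContDiffOn ℝ ∞ (ballValues v) (unitBall n) := by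
    intro x₀ hx₀
    have hx₀1 := mem_ball_zero_iff.1 hx₀
    set a := (‖x₀‖ + 1) / 2 with ha
    obtain ⟨K, r, R, hr, hR, hK, hK0, hrep⟩ := exists_evaluationKernel (n := n) (p := p) hn hp
      (a := a) (by positivity) (by linarith)
    obtain ⟨C, hC, hbd⟩ := exists_integral_norm_ballValues_le (n := n) (α := α) (β := β) hp hr hR
    have hint : Integrable ((annulus n r R).indicator (ballValues v)) :=
      (integrable_indicator_iff (isCompact_annulus r R).measurableSet).2 (hbd v hv).1
    -- With y reflected, `∫ K(x, y) v(y) dy` is a convolution evaluated at 0 with x as parameter, so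
    -- smoothness in x follows from smoothness of parametrised convolutions.
    let g : EuclideanSpace ℝ (Fin n) → EuclideanSpace ℝ (Fin n) → ℂ := fun x y =>
      K (rotVec 0 x) (-y)
    have hg : ContDiffOn ℝ ∞ (Function.uncurry g) (Metric.ball 0 a ×ˢ Set.univ) := by
      refine hK.comp (g := Function.uncurry K)
        (f := fun q : EuclideanSpace ℝ (Fin n) × EuclideanSpace ℝ (Fin n) =>
          (rotVec 0 q.1, -q.2)) ?_ ?_
      · exact ((((rotVecₗᵢ n 0).toContinuousLinearMap.contDiff).comp contDiff_fst).prodMk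
          contDiff_snd.neg).contDiffOn
      · rintro ⟨x, y⟩ ⟨hx, -⟩
        exact ⟨rotVec_mem_lieDomain 0 (mem_ball_zero_iff.1 hx), Set.mem_univ _⟩
    have hconv := contDiffOn_convolution_right_with_param (μ := volume) (n := ⊤)
      (ContinuousLinearMap.mul ℝ ℂ) (g := g) (f := (annulus n r R).indicator (ballValues v))
      Metric.isOpen_ball (isCompact_annulus (n := n) r R)
      (fun x y _ hy => hK0 _ _ (by
        rw [norm_neg]
        exact lt_or_lt_of_notMem_annulus hy)) hint.locallyIntegrable hg
    have hconv' : ContDiffOn ℝ ∞ (fun x => ∫ y, K (rotVec 0 x) y * ballValues v y)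
        (Metric.ball 0 a) := by
      have h1 := hconv.comp (contDiff_id.prodMk contDiff_const).contDiffOn
        (s := Metric.ball 0 a) (f := fun x => (x, 0)) fun x hx => ⟨hx, Set.mem_univ _⟩
      refine h1.congr fun x _ => ?_
      simp only [Function.comp, convolution, g, zero_sub, neg_neg, ContinuousLinearMap.mul_apply']
      refine integral_congr_ae (Eventually.of_forall fun y => ?_)
      by_cases hy : y ∈ annulus n r R
      · simp only [Set.indicator_of_mem hy]
        ring
      · simp [hK0 (rotVec 0 x) y (lt_or_lt_of_notMem_annulus hy)]
    have hmem : x₀ ∈ Metric.ball (0 : EuclideanSpace ℝ (Fin n)) a := by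
      rw [mem_ball_zero_iff]; linarith
    refine ((hconv'.contDiffAt (Metric.isOpen_ball.mem_nhds hmem)).congr_of_eventuallyEq
      ?_).contDiffWithinAt
    filter_upwards [Metric.isOpen_ball.mem_nhds hmem] with x hx
    have hxa := mem_ball_zero_iff.1 hx
    have hxB' : x ∈ unitBall n := by rw [mem_ball_zero_iff]; linarith
    rw [ballValues_coe hp v ⟨x, hxB'⟩]
    exact hrepv hr hR hK hK0 hrep 0 x hxa _ (rot_zero_coe hp _)
  -- A test function need not vanish near the origin, so `hker` does not apply. Instead the kernel,
  -- bounded uniformly for `|x| ≤ s`, gives uniform convergence on that ball.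
  have hdecay : ∀ φ : EuclideanSpace ℝ (Fin n) → ℂ, ContDiff ℝ ∞ φ → HasCompactSupport φ →
      ∀ r : ℝ, 0 < r → r < 1 → tsupport φ ⊆ Metric.closedBall 0 r →
      Tendsto (fun m => ∫ x, φ x * ballValues (w m) x) atTop
        (𝓝 (∫ x, φ x * ballValues v x)) := by
    intro φ hφ hc s hs0 hs hsupp
    obtain ⟨K, r, R, hr, hR, hK, hK0, hrep⟩ := exists_evaluationKernel (n := n) (p := p) hn hp
      (a := (s + 1) / 2) (by positivity) (by linarith)
    obtain ⟨C, hC, hbd⟩ := exists_norm_integral_mul_ballValues_le (n := n) (α := α) (β := β) hp hr hR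
    have hsa : ∀ x : EuclideanSpace ℝ (Fin n), x ∈ Metric.closedBall 0 s → ‖x‖ < (s + 1) / 2 :=
      fun x hx => by linarith [mem_closedBall_zero_iff.1 hx]
    obtain ⟨M, hM⟩ := ((isCompact_closedBall (0 : EuclideanSpace ℝ (Fin n)) s).prod
      (isCompact_annulus (n := n) r R)).exists_bound_of_continuousOn
      (f := fun q => K (rotVec 0 q.1) q.2)
      (ContinuousOn.comp (g := Function.uncurry K) hK.continuousOn
        (((continuous_rotVec 0).comp continuous_fst).prodMk continuous_snd).continuousOn
        fun q hq => ⟨rotVec_mem_lieDomain 0 (hsa _ hq.1), Set.mem_univ _⟩)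
    have hMK : ∀ x ∈ Metric.closedBall (0 : EuclideanSpace ℝ (Fin n)) s, ∀ y,
        ‖K (rotVec 0 x) y‖ ≤ |M| := by
      intro x hx y
      by_cases hy : y ∈ annulus n r R
      · exact (hM (x, y) ⟨hx, hy⟩).trans (le_abs_self M)
      · rw [hK0 _ _ (lt_or_lt_of_notMem_annulus hy), norm_zero]
        exact abs_nonneg M
    have hdiff : ∀ m, ∀ x ∈ Metric.closedBall (0 : EuclideanSpace ℝ (Fin n)) s,
        ‖ballValues (w m) x - ballValues v x‖ ≤
          |M| * (C * (eLpNorm (w m - v) 2 (hatMeasure n p α β)).toReal) := by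
      intro m x hx
      have hxB' : x ∈ unitBall n := by rw [mem_ball_zero_iff]; linarith [hsa x hx]
      have hcont : Continuous (K (rotVec 0 x)) :=
        (hK.comp_contDiff (contDiff_prodMk_right _)
          fun y => ⟨rotVec_mem_lieDomain 0 (hsa x hx), Set.mem_univ _⟩).continuous
      rw [← hFu m x hxB', hrep _ _ (hsm m) (hF m) (hFu m) 0 x (hsa x hx),
        ballValues_coe hp v ⟨x, hxB'⟩,
        hrepv hr hR hK hK0 hrep 0 x (hsa x hx) _ (rot_zero_coe hp _),
        ← integral_sub (hbd _ (hw m).2 _ _ hcont (hMK x hx) (hK0 _)).1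
          (hbd _ hv _ _ hcont (hMK x hx) (hK0 _)).1]
      have h1 := (hbd (w m - v) ((hw m).2.sub hv) _ _ hcont (hMK x hx) (hK0 _)).2
      simpa [ballValues_sub, mul_sub] using h1
    have hsub : tsupport φ ⊆ unitBall n := hsupp.trans (Metric.closedBall_subset_ball hs)
    have hint : ∀ {u : EuclideanSpace ℝ (Fin n) → ℂ}, ContDiffOn ℝ ∞ u (unitBall n) →
        Integrable fun x => φ x * u x := fun hu =>
      (contDiff_mul_of_tsupport_subset Metric.isOpen_ball hφ hu
        hsub).continuous.integrable_of_hasCompactSupport hc.mul_right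
    rw [tendsto_iff_norm_sub_tendsto_zero]
    refine squeeze_zero (g := fun m => (∫ x, ‖φ x‖) *
      (|M| * (C * (eLpNorm (w m - v) 2 (hatMeasure n p α β)).toReal)))
      (fun _ => norm_nonneg _) (fun m => ?_)
      (by simpa using ((hlim.const_mul C).const_mul |M|).const_mul (∫ x, ‖φ x‖))
    rw [← integral_sub (hint (hsm m).1) (hint hsmooth), ← integral_mul_const]
    refine norm_integral_le_of_norm_le
      ((hφ.continuous.integrable_of_hasCompactSupport hc).norm.mul_const _)
      (Eventually.of_forall fun x => ?_)
    rw [← mul_sub, norm_mul]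
    by_cases hx : x ∈ tsupport φ
    · exact mul_le_mul_of_nonneg_left (hdiff m x (hsupp hx)) (norm_nonneg _)
    · simp [image_eq_zero_of_notMem_tsupport hx]
  have hpoly : IsSmoothPolyharmonicOn p (ballValues v) (unitBall n) := by
    -- The integrals of the limit against `Δ^p φ` vanish as limits of zeros. Since the limit is
    -- smooth, `Δ^p` moves back onto it, so `Δ^p v = 0` almost everywhere and, by continuity,
    -- everywhere on the ball.
    refine ⟨hsmooth, ?_⟩
    have hcontΔ := (hsmooth.iterate_laplacian Metric.isOpen_ball p).continuousOn
    have hae := Metric.isOpen_ball.ae_eq_zero_of_integral_contDiff_smul_eq_zero (μ := volume)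
      (hcontΔ.locallyIntegrableOn Metric.isOpen_ball.measurableSet) ?_
    · refine Measure.eqOn_open_of_ae_eq (μ := volume) (g := 0) ?_ Metric.isOpen_ball hcontΔ
        continuousOn_const
      exact (ae_restrict_iff' Metric.isOpen_ball.measurableSet).2 hae
    · intro g hg hgc hgs
      obtain ⟨s', hs', hsub⟩ := exists_lt_subset_ball (isClosed_tsupport g) hgs
      set s := max s' (1 / 2) with hsdef
      have hs : s < 1 := max_lt hs' (by norm_num)
      have hs0 : 0 < s := lt_of_lt_of_le (by norm_num) (le_max_right _ _)
      have hφ : ContDiff ℝ ∞ fun x => (g x : ℂ) := Complex.ofRealCLM.contDiff.comp hg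
      have hφc : HasCompactSupport fun x => (g x : ℂ) := hgc.comp_left Complex.ofReal_zero
      have hφs : tsupport (fun x => (g x : ℂ)) ⊆ Metric.closedBall 0 s := by
        refine (closure_mono fun x hx => ?_).trans (hsub.trans
          (Metric.ball_subset_closedBall.trans (Metric.closedBall_subset_closedBall
            (le_max_left _ _))))
        simpa using hx
      have h1 := hdecay _ (hφ.iterate_laplacian p) (hφc.iterate_laplacian p) s hs0 hs
        ((tsupport_iterate_laplacian_subset _ p).trans hφs)
      have h2 : ∀ m, ∫ x, (fun v : EuclideanSpace ℝ (Fin n) → ℂ => Δ v)^[p]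
          (fun x => (g x : ℂ)) x * ballValues (w m) x = 0 := by
        intro m
        rw [← integral_mul_iterate_laplacian_of_contDiffOn (hsm m).1 hφ hs0 hs hφs p]
        refine integral_eq_zero_of_ae (Eventually.of_forall fun x => ?_)
        by_cases hx : x ∈ unitBall n
        · simp [(hsm m).2 x hx]
        · have : g x = 0 := image_eq_zero_of_notMem_tsupport fun h => hx (hgs h)
          simp [this]
      simp only [h2] at h1
      rw [← integral_mul_iterate_laplacian_of_contDiffOn hsmooth hφ hs0 hs hφs p] at h1
      simpa using tendsto_nhds_unique h1 tendsto_const_nhds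
  obtain ⟨F', hF', hFv'⟩ := hpoly.exists_analyticOnNhd_allRotations hn hp
  refine ⟨⟨ballValues v, ⟨fun x hx => ?_, hpoly.2⟩, F', hF', hFv', fun z => ?_⟩, hv⟩
  · have h1 : AnalyticAt ℝ (fun x => F' (rotVec 0 x)) x :=
      AnalyticAt.fun_comp (g := F') (f := rotVec 0)
        (hF' _ (rotVec_mem_allRotations 0 hx)).restrictScalars
        ((rotVecₗᵢ n 0).toContinuousLinearMap.analyticAt x)
    refine h1.congr ?_
    filter_upwards [Metric.isOpen_ball.mem_nhds hx] with y hy using hFv' y hy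
  · obtain ⟨k, x, hx, hz⟩ := Set.mem_iUnion.1 z.2
    have hx1 := mem_ball_zero_iff.1 hx
    obtain ⟨K, r, R, hr, hR, hK, hK0, hrep⟩ := exists_evaluationKernel (n := n) (p := p) hn hp
      (a := (‖x‖ + 1) / 2) (by positivity) (by linarith)
    -- The limit and the extension of its real values are given by the same integral, so they agree
    -- on every rotated ball and not just on B.
    rw [hrepv hr hR hK hK0 hrep (k * Real.pi / p) x (by linarith) z hz.symm, ← hz]
    exact hrep _ _ hpoly hF' hFv' _ x (by linarith)

end Limits

/-! ### Closedness in `L²` and the reproducing kernel -/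

section BergmanSpace

open Filter Topology

variable {n p : ℕ} {α β : ℝ}

/-- The inclusion of the Bergman space into `L²`. -/
noncomputable def bergmanToL2 (n p : ℕ) (α β : ℝ) :
    bergmanSubmodule n p α β →ₗ[ℂ] HatL2 n p α β where
  toFun w := MemLp.toLp w.1 w.2.2
  map_add' w w' := MemLp.toLp_add w.2.2 w'.2.2
  map_smul' c w := MemLp.toLp_const_smul c w.2.2

theorem coeFn_bergmanToL2 (w : bergmanSubmodule n p α β) :
    bergmanToL2 n p α β w =ᵐ[hatMeasure n p α β] w.1 :=
  MemLp.coeFn_toLp w.2.2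

theorem norm_bergmanToL2 (w : bergmanSubmodule n p α β) :
    ‖bergmanToL2 n p α β w‖ = (eLpNorm w.1 2 (hatMeasure n p α β)).toReal :=
  Lp.norm_toLp _ w.2.2

theorem bergmanToL2_injective (hn : 1 ≤ n) (hp : 1 ≤ p) :
    Function.Injective (bergmanToL2 n p α β) := fun w w' h =>
  Subtype.ext (eq_of_ae_eq_of_mem_bergman hn hp w.2 w'.2
    ((MemLp.toLp_eq_toLp_iff w.2.2 w'.2.2).1 h))

theorem coe_range_bergmanToL2 :
    (LinearMap.range (bergmanToL2 n p α β) : Set (HatL2 n p α β)) = bergmanL2 n p α β := by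
  ext f
  constructor
  · rintro ⟨w, rfl⟩
    exact ⟨w, w.2, coeFn_bergmanToL2 w⟩
  · rintro ⟨w, hw, hfw⟩
    exact ⟨⟨w, hw⟩, Lp.ext ((coeFn_bergmanToL2 _).trans hfw.symm)⟩

/-- Point evaluations are bounded on the Bergman space. -/
theorem exists_norm_apply_le (hn : 1 ≤ n) (hp : 1 ≤ p) (z : hatB n p) :
    ∃ C, 0 ≤ C ∧ ∀ w : bergmanSubmodule n p α β, ‖w.1 z‖ ≤ C * ‖bergmanToL2 n p α β w‖ := by
  obtain ⟨C, hC0, hC⟩ := exists_norm_le_of_mem_bergman (α := α) (β := β) hn hp z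
  exact ⟨C, hC0, fun w => by rw [norm_bergmanToL2]; exact hC w.1 w.2⟩

/-- Bounded evaluations make an L²-convergent sequence pointwise Cauchy. A subsequence converges
almost everywhere to the L² limit, so the pointwise limit represents it. -/
theorem isClosed_range_bergmanToL2 (hn : 1 ≤ n) (hp : 1 ≤ p) :
    IsClosed (LinearMap.range (bergmanToL2 n p α β) : Set (HatL2 n p α β)) := by
  refine isClosed_of_closure_subset fun f hf => ?_
  obtain ⟨g, hg, hgf⟩ := mem_closure_iff_seq_limit.1 hf
  choose w hw using hg
  have hTf : Tendsto (fun m => bergmanToL2 n p α β (w m)) atTop (𝓝 f) := by simpa only [hw] using hgf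
  have hcauchy : ∀ z, CauchySeq fun m => (w m).1 z := by
    intro z
    obtain ⟨C, hC0, hC⟩ := exists_norm_apply_le (α := α) (β := β) hn hp z
    rw [Metric.cauchySeq_iff']
    intro ε hε
    obtain ⟨N, hN⟩ := Metric.cauchySeq_iff'.1 hTf.cauchySeq (ε / (C + 1)) (by positivity)
    refine ⟨N, fun m hm => ?_⟩
    have h1 := hC (w m - w N)
    have h2 := hN m hm
    rw [dist_eq_norm, ← map_sub, lt_div_iff₀ (by positivity)] at h2
    rw [dist_eq_norm]
    refine (h1.trans ?_).trans_lt h2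
    nlinarith [norm_nonneg (bergmanToL2 n p α β (w m - w N))]
  choose v hv using fun z => cauchySeq_tendsto_of_complete (hcauchy z)
  obtain ⟨ns, hns, hae⟩ := (tendstoInMeasure_of_tendsto_Lp hTf).exists_seq_tendsto_ae
  have hfv : f =ᵐ[hatMeasure n p α β] v := by
    filter_upwards [hae, ae_all_iff.2 fun m => coeFn_bergmanToL2 (w m)] with z h1 h2
    simp only [h2] at h1
    exact tendsto_nhds_unique h1 ((hv z).comp hns.tendsto_atTop)
  have hvL : MemLp v 2 (hatMeasure n p α β) := (memLp_congr_ae hfv).1 (Lp.memLp f)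
  have hlim : Tendsto (fun m => (eLpNorm ((w m).1 - v) 2 (hatMeasure n p α β)).toReal) atTop
      (𝓝 0) := by
    refine (tendsto_iff_norm_sub_tendsto_zero.1 hTf).congr fun m => ?_
    rw [Lp.norm_def]
    refine congrArg ENNReal.toReal (eLpNorm_congr_ae ?_)
    filter_upwards [Lp.coeFn_sub (bergmanToL2 n p α β (w m)) f, coeFn_bergmanToL2 (w m), hfv]
      with z h1 h2 h3
    rw [h1, Pi.sub_apply, Pi.sub_apply, h2, h3]
  exact ⟨⟨v, mem_bergman_of_tendsto hn hp (fun m => (w m).2) hvL hlim hv⟩,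
    Lp.ext ((coeFn_bergmanToL2 _).trans hfv.symm)⟩

theorem hatInner_eq_inner (hp : 1 ≤ p) (u v : bergmanSubmodule n p α β) :
    hatInner α β u.1 v.1 = inner ℂ (bergmanToL2 n p α β v) (bergmanToL2 n p α β u) := by
  rw [inner_eq_hatInner hp]
  exact hatInner_congr_ae hp u.2.2 v.2.2 (coeFn_bergmanToL2 u).symm (coeFn_bergmanToL2 v).symm

/-- The Riesz representation of point evaluations on the Bergman space. -/
theorem exists_mem_bergman_apply_eq_hatInner (hn : 1 ≤ n) (hp : 1 ≤ p) (z : hatB n p) :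
    ∃ r ∈ bergman n p α β, ∀ u ∈ bergman n p α β, u z = hatInner α β u r := by
  obtain ⟨C, -, hC⟩ := exists_norm_apply_le (α := α) (β := β) hn hp z
  have : CompleteSpace (LinearMap.range (bergmanToL2 n p α β)) :=
    (isClosed_range_bergmanToL2 hn hp).completeSpace_coe
  set e := LinearEquiv.ofInjective (bergmanToL2 n p α β) (bergmanToL2_injective hn hp)
  have he : ∀ w, (e w : HatL2 n p α β) = bergmanToL2 n p α β w := fun w =>
    LinearEquiv.ofInjective_apply _ w
  -- The function space carries no norm of its own, so evaluation is transported to the closed range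
  -- in L², where Riesz representation applies.
  let ev : LinearMap.range (bergmanToL2 n p α β) →L[ℂ] ℂ :=
    ((LinearMap.proj z ∘ₗ (bergmanSubmodule n p α β).subtype) ∘ₗ e.symm.toLinearMap).mkContinuous C
      fun f => by
        obtain ⟨w, rfl⟩ := e.surjective f
        have := hC w
        rw [← he] at this
        simpa using this
  obtain ⟨r, hr⟩ := e.surjective ((InnerProductSpace.toDual ℂ _).symm ev)
  refine ⟨r.1, r.2, fun u hu => ?_⟩
  rw [hatInner_eq_inner hp ⟨u, hu⟩ r, ← he, ← he, ← Submodule.coe_inner, hr,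
    InnerProductSpace.toDual_symm_apply]
  simp [ev]

/-- The difference of the two representers is orthogonal to the whole space, in particular to
itself. -/
theorem eq_of_forall_hatInner_eq (hn : 1 ≤ n) (hp : 1 ≤ p) {r r' : hatB n p → ℂ}
    (hr : r ∈ bergman n p α β) (hr' : r' ∈ bergman n p α β)
    (h : ∀ u ∈ bergman n p α β, hatInner α β u r = hatInner α β u r') : r = r' := by
  let r₁ : bergmanSubmodule n p α β := ⟨r, hr⟩
  let r₂ : bergmanSubmodule n p α β := ⟨r', hr'⟩
  have h1 : ∀ u : bergmanSubmodule n p α β,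
      inner ℂ (bergmanToL2 n p α β (r₁ - r₂)) (bergmanToL2 n p α β u) = 0 := by
    intro u
    rw [map_sub, inner_sub_left, ← hatInner_eq_inner hp, ← hatInner_eq_inner hp, h u.1 u.2,
      sub_self]
  have h2 := bergmanToL2_injective hn hp ((inner_self_eq_zero.1 (h1 (r₁ - r₂))).trans
    (map_zero _).symm)
  exact congrArg Subtype.val (sub_eq_zero.1 h2)

end BergmanSpace

theorem corollary1 (n p : ℕ) (hn : 1 ≤ n) (hp : 1 ≤ p) (α β : ℝ)
    (hα : 0 < (n : ℝ) + α) (hβ : -1 < β) :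
    -- every polyharmonic function on the ball has exactly one extension to the rotated balls
    (∀ u : EuclideanSpace ℝ (Fin n) → ℂ, IsPolyharmonicOn p u (unitBall n) →
      ∃! w : hatB n p → ℂ, IsRotExtension u w) ∧
    -- the inner product of the Hilbert space `L²` is the stated one
    (∀ f g : HatL2 n p α β, inner ℂ g f = hatInner α β f g) ∧
    -- the elements of the Bergman space are determined by their classes in `L²`
    (∀ u ∈ bergman n p α β, ∀ v ∈ bergman n p α β, u =ᵐ[hatMeasure n p α β] v → u = v) ∧
    -- the Bergman space is a closed subspace of `L²`, hence a Hilbert space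
    (∃ S : Submodule ℂ (HatL2 n p α β), (S : Set (HatL2 n p α β)) = bergmanL2 n p α β ∧
      IsClosed (S : Set (HatL2 n p α β)) ∧ CompleteSpace S) ∧
    -- the Bergman space has a (unique) reproducing kernel
    (∃! R : hatB n p → hatB n p → ℂ, ∀ x : hatB n p, R x ∈ bergman n p α β ∧
      ∀ u ∈ bergman n p α β, u x = hatInner α β u (R x)) := by
  refine ⟨fun u hu => existsUnique_isRotExtension hn hp hu, inner_eq_hatInner hp,
    fun u hu v hv => eq_of_ae_eq_of_mem_bergman hn hp hu hv,
    ⟨LinearMap.range (bergmanToL2 n p α β), coe_range_bergmanToL2,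
      isClosed_range_bergmanToL2 hn hp, (isClosed_range_bergmanToL2 hn hp).completeSpace_coe⟩, ?_⟩
  choose R hR hRu using exists_mem_bergman_apply_eq_hatInner (n := n) (p := p) (α := α) (β := β)
    hn hp
  refine ⟨R, fun x => ⟨hR x, hRu x⟩, fun R' hR' => funext fun x => ?_⟩
  exact eq_of_forall_hatInner_eq hn hp (hR' x).1 (hR x) fun u hu =>
    ((hR' x).2 u hu).symm.trans (hRu x u hu)
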